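/- Let $G=(V,E)$ be a finite connected simple undirected graph with $n\ge 2$ vertices, let $1<p<\infty$, and let $f_0:V\to[0,1]$. Given a sequence $v_1,v_2,\dots$ of update vertices in $V$, the $\ell^p$-energy minimization dynamics are defined, for $t\ge 1$, by $$f_t(v_t)=\operatorname{argmin}_{y\in\mathbb R}\sum_{w\sim v_t}|f_{t-1}(w)-y|^p,\qquad f_t(v)=f_{t-1}(v)\ \text{ for } v\ne v_t .$$ Write $\mathcal E_p(f)=\sum_{\{u,v\}\in E}|f(u)-f(v)|^p$, $\operatorname{osc}(f)=\max_V f-\min_V f$, and $\tau_p(\epsilon)=\min\{t\ge 0:\operatorname{osc}(f_t)\le\epsilon\}$ (with $\min\emptyset=\infty$). Let $\beta_p=\max\{\tfrac{2p}{p-1},3\}$. **Theorem.** Fix $1<p<\infty$. There are constants $C_p,c_p>0$, depending only on $p$, such that for every $n\ge2$, every connected graph $G=(V,E)$ with $|V|=n$ and every $f_0:V\to[0,1]$, if the update vertices $v_1,v_2,\dots$ are independent and uniformly distributed on $V$, then (a) $\mathbb E[\mathcal E_p(f_t)]\le e^{-c_p n^{-\beta_p}t}\,\mathcal E_p(f_0)$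 for all integers $t\ge 0$; (b) $\mathbb E[\tau_p(\epsilon)]\le C_p\, n^{\beta_p}\log\frac n\epsilon$ for all $\epsilon\in(0,1/2]$. Conversely, there is $\tilde c_p>0$, depending only on $p$, such that for all sufficiently large $N$ there exist a connected graph $G=(V,E)$ with $|V|\le N$ and an initial profile $f_0:V\to[0,1]$ with $$\tau_p(1/2)\ge\tilde c_p N^{\beta_p}\qquad\text{for every sequence of update vertices.}$$ Moreover, for $1<p\le 3$ the graph $G$ can be taken to be a barbell (for some $k\ge2$, two cliques of size $k$ joined by a segment of length $2k$ whose two endpoints each belong to one of the cliques, $4k-1$ vertices in total), and for $p\ge3$ it can be taken to be a cycle. -/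

import Mathlib

open MeasureTheory ProbabilityTheory Filter
open scoped ENNReal

noncomputable section

namespace LpConsensus

/-- The exponent `β_p = max (2p/(p-1), 3)`. -/
def beta (p : ℝ) : ℝ := max (2 * p / (p - 1)) 3

section Dynamics

variable {V : Type*} [Fintype V]

open scoped Classical in
/-- The sum `∑_{w ∼ v} |f w - y|^p` which an update at `v` minimizes over `y`. -/
def localSum (p : ℝ) (G : SimpleGraph V) (f : V → ℝ) (v : V) (y : ℝ) : ℝ :=
  ∑ w ∈ G.neighborFinset v, |f w - y| ^ p

/-- The minimizer of `y ↦ ∑_{w ∼ v} |f w - y|^p`. For `1 < p` and a vertex `v` with at least one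
neighbour it exists and is unique, see `localSum_argmin_le` and `eq_argmin` below. -/
def argmin (p : ℝ) (G : SimpleGraph V) (f : V → ℝ) (v : V) : ℝ :=
  Classical.epsilon fun y : ℝ => ∀ z : ℝ, localSum p G f v y ≤ localSum p G f v z

theorem continuous_localSum {p : ℝ} (hp : 1 < p) (G : SimpleGraph V) (f : V → ℝ) (v : V) :
    Continuous (localSum p G f v) := by
  unfold localSum
  refine continuous_finsetSum _ fun w _ => ?_
  exact (Continuous.rpow_const (by fun_prop) fun _ => Or.inr (by linarith))

theorem localSum_argmin_le {p : ℝ} (hp : 1 < p) (G : SimpleGraph V) (f : V → ℝ) (v : V) (z : ℝ) :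
    localSum p G f v (argmin p G f v) ≤ localSum p G f v z := by
  classical
  have hex : ∃ y : ℝ, ∀ z : ℝ, localSum p G f v y ≤ localSum p G f v z := by
    by_cases hv : (G.neighborFinset v).Nonempty
    · obtain ⟨w, hw⟩ := hv
      have hp0 : 0 < p := by linarith
      refine (continuous_localSum hp G f v).exists_forall_le ?_
      have h1 : Tendsto (fun y : ℝ => |f w - y| ^ p) (cocompact ℝ) atTop := by
        refine (tendsto_rpow_atTop hp0).comp ?_
        have h2 : Tendsto (fun y : ℝ => ‖y‖ + (-|f w|)) (cocompact ℝ) atTop :=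
          tendsto_atTop_add_const_right _ _ (tendsto_norm_cocompact_atTop (E := ℝ))
        refine tendsto_atTop_mono (fun y => ?_) h2
        have := abs_sub_abs_le_abs_sub y (f w)
        rw [abs_sub_comm y] at this
        simpa [sub_eq_add_neg] using this
      refine tendsto_atTop_mono (fun y => ?_) h1
      unfold localSum
      convert Finset.single_le_sum (f := fun w => |f w - y| ^ p)
        (fun i _ => Real.rpow_nonneg (abs_nonneg _) p) hw
    · refine ⟨0, fun z => ?_⟩
      have h0 : G.neighborFinset v = ∅ := Finset.not_nonempty_iff_eq_empty.mp hv
      have h : ∀ y, localSum p G f v y = 0 := by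
        intro y
        unfold localSum
        refine Finset.sum_eq_zero fun w hw => ?_
        have hw' : w ∈ G.neighborFinset v := by simpa using hw
        rw [h0] at hw'
        simp at hw'
      rw [h, h]
  exact Classical.epsilon_spec (p := fun y : ℝ => ∀ z, localSum p G f v y ≤ localSum p G f v z)
    hex z

theorem eq_argmin {p : ℝ} (hp : 1 < p) (G : SimpleGraph V) (f : V → ℝ) {v w : V}
    (hvw : G.Adj v w) {y : ℝ} (hy : ∀ z : ℝ, localSum p G f v y ≤ localSum p G f v z) :
    y = argmin p G f v := by
  classical
  by_contra hne
  set x := argmin p G f v with hx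
  have hp0 : 0 < p := by linarith
  have hconv := strictConvexOn_rpow hp
  -- midpoint inequality for each summand
  have key : ∀ a b : ℝ, |(a + b) / 2| ^ p ≤ (|a| ^ p + |b| ^ p) / 2 := by
    intro a b
    have h1 : |(a + b) / 2| ≤ (1 / 2 : ℝ) • |a| + (1 / 2 : ℝ) • |b| := by
      rw [abs_div, abs_two]
      have := abs_add_le a b
      simp only [smul_eq_mul]
      linarith
    have h2 := hconv.convexOn.2 (Set.mem_Ici.mpr (abs_nonneg a)) (Set.mem_Ici.mpr (abs_nonneg b))
      (by norm_num : (0 : ℝ) ≤ 1 / 2) (by norm_num : (0 : ℝ) ≤ 1 / 2) (by norm_num)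
    have h3 := Real.rpow_le_rpow (abs_nonneg _) h1 hp0.le
    simp only [smul_eq_mul] at h2 h3
    linarith
  have keys : ∀ a b : ℝ, a ≠ b → |(a + b) / 2| ^ p < (|a| ^ p + |b| ^ p) / 2 := by
    intro a b hab
    by_cases habs : |a| = |b|
    · have hba : b = -a := by
        rcases abs_eq_abs.mp habs with h | h
        · exact absurd h hab
        · linarith
      subst hba
      have ha : a ≠ 0 := by
        rintro rfl
        simp at hab
      have := Real.rpow_pos_of_pos (abs_pos.mpr ha) p
      simp only [add_neg_cancel, zero_div, abs_zero, abs_neg, Real.zero_rpow hp0.ne']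
      linarith
    · have h1 : |(a + b) / 2| ≤ (1 / 2 : ℝ) • |a| + (1 / 2 : ℝ) • |b| := by
        rw [abs_div, abs_two]
        have := abs_add_le a b
        simp only [smul_eq_mul]
        linarith
      have h2 := hconv.2 (Set.mem_Ici.mpr (abs_nonneg a)) (Set.mem_Ici.mpr (abs_nonneg b)) habs
        (by norm_num : (0 : ℝ) < 1 / 2) (by norm_num : (0 : ℝ) < 1 / 2) (by norm_num)
      have h3 := Real.rpow_le_rpow (abs_nonneg _) h1 hp0.le
      simp only [smul_eq_mul] at h2 h3
      linarith
  have hmem : w ∈ G.neighborFinset v := by simpa using hvw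
  have hlt : localSum p G f v ((y + x) / 2)
      < (localSum p G f v y + localSum p G f v x) / 2 := by
    have hs : (localSum p G f v y + localSum p G f v x) / 2
        = ∑ w ∈ G.neighborFinset v, (|f w - y| ^ p + |f w - x| ^ p) / 2 := by
      unfold localSum
      rw [← Finset.sum_div, Finset.sum_add_distrib]
    have hm : localSum p G f v ((y + x) / 2)
        = ∑ w ∈ G.neighborFinset v, |((f w - y) + (f w - x)) / 2| ^ p := by
      unfold localSum
      refine Finset.sum_congr (by congr!) fun u _ => ?_
      congr 2
      ring
    rw [hs, hm]
    refine Finset.sum_lt_sum (fun u _ => key _ _) ⟨w, hmem, keys _ _ fun h => hne ?_⟩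
    linarith
  have hA := hy ((y + x) / 2)
  have hB := localSum_argmin_le hp G f v ((y + x) / 2)
  rw [← hx] at hB
  linarith

open scoped Classical in
/-- One step of the `ℓ^p`-energy minimization dynamics: the opinion at `v` is replaced by the
minimizer, all other opinions are left unchanged. -/
def step (p : ℝ) (G : SimpleGraph V) (f : V → ℝ) (v : V) : V → ℝ :=
  fun u => if u = v then argmin p G f v else f u

/-- The profile `f_t` at time `t`, started from `f₀`, when `v t` is the vertex that is updated in
the step from time `t` to time `t + 1`. -/
def profile (p : ℝ) (G : SimpleGraph V) (f₀ : V → ℝ) (v : ℕ → V) : ℕ → V → ℝ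
  | 0 => f₀
  | t + 1 => step p G (profile p G f₀ v t) (v t)

open scoped Classical in
/-- The `ℓ^p` energy `∑_{{u,v} ∈ E} |f u - f v|^p`, each (unordered) edge counted once. -/
def energy (p : ℝ) (G : SimpleGraph V) (f : V → ℝ) : ℝ :=
  ∑ e ∈ G.edgeFinset,
    Sym2.lift ⟨fun u v => |f u - f v| ^ p, fun u v => by simp only [abs_sub_comm]⟩ e

end Dynamics

/-- The oscillation `max f - min f` (for a finite nonempty vertex set). -/
def osc {V : Type*} (f : V → ℝ) : ℝ := (⨆ v, f v) - ⨅ v, f v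

/-- The `ε`-consensus time: the least `t ≥ 0` with `osc (f_t) ≤ ε`, and `∞` if there is none. -/
def consensusTime {V : Type*} [Fintype V] (p : ℝ) (G : SimpleGraph V) (f₀ : V → ℝ) (v : ℕ → V)
    (ε : ℝ) : ℕ∞ :=
  ⨅ (t : ℕ) (_ : osc (profile p G f₀ v t) ≤ ε), (t : ℕ∞)

/-- The vertices `v 0, v 1, …` are independent and uniformly distributed on `V`. -/
structure IsUniformUpdates {V Ω : Type*} [MeasurableSpace V] [MeasurableSpace Ω]
    (P : Measure Ω) (v : ℕ → Ω → V) : Prop where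
  measurable : ∀ t, Measurable (v t)
  indep : iIndepFun v P
  uniform : ∀ t, P.map (v t) = uniformOn Set.univ

/-- The barbell graph with `4k - 1` vertices: two cliques of size `k`, on `{0, …, k-1}` and on
`{3k-1, …, 4k-2}`, joined by the segment `k-1, k, …, 3k-1` of length `2k`. -/
def barbell (k : ℕ) : SimpleGraph (Fin (4 * k - 1)) where
  Adj i j := i ≠ j ∧
    (((i : ℕ) < k ∧ (j : ℕ) < k) ∨ (3 * k ≤ (i : ℕ) + 1 ∧ 3 * k ≤ (j : ℕ) + 1) ∨
      (i : ℕ) + 1 = j ∨ (j : ℕ) + 1 = i)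
  symm := ⟨fun i j h => ⟨h.1.symm, by have := h.2; omega⟩⟩
  loopless := ⟨fun _ h => h.1 rfl⟩

/-- `G` is a connected graph with at most `N` vertices that has an initial profile with values in
`[0,1]` from which the `1/2`-consensus time is at least `a * N ^ β_p`, whatever the sequence of
updated vertices. -/
def IsSlow {V : Type*} [Fintype V] (p a : ℝ) (N : ℕ) (G : SimpleGraph V) : Prop :=
  G.Connected ∧ Fintype.card V ≤ N ∧
    ∃ f₀ : V → ℝ, (∀ x, f₀ x ∈ Set.Icc (0 : ℝ) 1) ∧
      ∀ v : ℕ → V,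
        ENNReal.ofReal (a * (N : ℝ) ^ beta p) ≤ (consensusTime p G f₀ v (1 / 2) : ℝ≥0∞)

end LpConsensus

end

/-! Upper bound. Let D_v be the p-Laplacian of f at v (`flux`), T = Σ|D_v|, E the energy, n the
number of vertices, and Δ the sum over v of the energy drops caused by updating v. Everything rests
on E ≤ C n^(β-1) Δ (`exists_energy_le_sum_drop`): a uniform update then removes on average a
fraction n^(-β)/C of the energy, which gives (a), and Markov's inequality summed over t gives (b).

To bound Δ from below, shift f(v) by h: this gains p|D_v|h up to an error K(h² A_v + n h^p), where
A_v = Σ_{w∼v} |f w - f v|^(p-2) if p > 2 and A_v = 0 if p ≤ 2. Choosing h and summing over v,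
`total_flux_le_of_drop` yields T^(p/(p-1)) ≲ n^(2/(p-1)) Δ or T² ≲ Δ ΣA_v. To bound E from above,
note that the flow of `phi` through any cut is at most T. On a level cut all terms have one sign, so
no increment along an edge exceeds L = T^(1/(p-1)); hence f varies by at most nL, and summation by
parts gives E ≤ nLT. The first alternative then suffices. The second needs a bound on ΣA_v by T. For
this the vertices are ranked by value, and edges with rank difference R and increment l are split
according to whether R² l^(p-1) ≤ T (`sum_rpow_sub_two_le`).

Lower bound, p ≤ 3. On the barbell, start linearly along the segment, with slope about 1/k. An
endpoint of the segment is held by k-1 clique neighbours, so it rises above its clique by only η ≈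
k^(-1-1/(p-1)); a clique vertex feels only that one high neighbour, so k/2 updates raise the clique
by only ζ ≈ k^(-1-2/(p-1)). A change of constant size thus takes about k/ζ ≈ k^(2p/(p-1)) updates,
whatever their order. An explicit supersolution (`barrier`) makes this rigorous.

Lower bound, p ≥ 3. On a cycle every update is averaging of two neighbours, for every p. The
quadratic energy drops by twice the square of each move and starts at order 1/n, while consensus
needs total displacement of order n, so Cauchy-Schwarz forces order n³ updates. -/

namespace LpConsensus

/-! ### The derivative of |x|^p and first order expansions with error terms -/

/-- The odd power `sgn x * |x| ^ (p - 1)`, the derivative of `|x| ^ p / p`. -/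
noncomputable def phi (p x : ℝ) : ℝ := if 0 ≤ x then x ^ (p - 1) else -(-x) ^ (p - 1)

theorem phi_of_nonneg (p : ℝ) {x : ℝ} (hx : 0 ≤ x) : phi p x = x ^ (p - 1) := if_pos hx

theorem phi_zero {p : ℝ} (hp : 1 < p) : phi p 0 = 0 := by
  rw [phi_of_nonneg p le_rfl, Real.zero_rpow (by linarith)]

theorem phi_neg {p : ℝ} (hp : 1 < p) (x : ℝ) : phi p (-x) = -phi p x := by
  rcases lt_trichotomy x 0 with h | h | h
  · simp [phi, h.not_ge, h.le]
  · simp [h, phi_zero hp]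
  · simp [phi, h.not_ge, h.le]

theorem phi_of_nonpos {p : ℝ} (hp : 1 < p) {x : ℝ} (hx : x ≤ 0) : phi p x = -(-x) ^ (p - 1) := by
  rw [← neg_neg x, phi_neg hp, phi_of_nonneg p (by linarith), neg_neg x]

theorem abs_phi {p : ℝ} (hp : 1 < p) (x : ℝ) : |phi p x| = |x| ^ (p - 1) := by
  rcases le_total 0 x with h | h
  · rw [phi_of_nonneg p h, abs_of_nonneg h, abs_of_nonneg (Real.rpow_nonneg h _)]
  · rw [phi_of_nonpos hp h, abs_of_nonpos h, abs_neg,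
      abs_of_nonneg (Real.rpow_nonneg (by linarith) _)]

theorem phi_nonneg {p : ℝ} {x : ℝ} (hx : 0 ≤ x) : 0 ≤ phi p x := by
  rw [phi_of_nonneg p hx]; exact Real.rpow_nonneg hx _

theorem phi_nonpos {p : ℝ} (hp : 1 < p) {x : ℝ} (hx : x ≤ 0) : phi p x ≤ 0 := by
  rw [phi_of_nonpos hp hx]; linarith [Real.rpow_nonneg (neg_nonneg.mpr hx) (p - 1)]

theorem phi_mono {p : ℝ} (hp : 1 < p) : Monotone (phi p) := by
  intro x y hxy
  rcases le_total 0 x with hx | hx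
  · rw [phi_of_nonneg p hx, phi_of_nonneg p (hx.trans hxy)]
    exact Real.rpow_le_rpow hx hxy (by linarith)
  · rcases le_total 0 y with hy | hy
    · exact (phi_nonpos hp hx).trans (phi_nonneg hy)
    · rw [phi_of_nonpos hp hx, phi_of_nonpos hp hy]
      exact neg_le_neg (Real.rpow_le_rpow (by linarith) (by linarith) (by linarith))

theorem rpow_sub_one_mul_self {p : ℝ} (hp : 1 < p) {x : ℝ} (hx : 0 ≤ x) :
    x ^ (p - 1) * x = x ^ p := by
  have := Real.rpow_add_one' hx (y := p - 1) (by linarith)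
  rw [← this]; congr 1; ring

theorem phi_mul_self {p : ℝ} (hp : 1 < p) (x : ℝ) : phi p x * x = |x| ^ p := by
  rcases le_total 0 x with h | h
  · rw [phi_of_nonneg p h, abs_of_nonneg h, rpow_sub_one_mul_self hp h]
  · rw [phi_of_nonpos hp h, abs_of_nonpos h, ← rpow_sub_one_mul_self hp (neg_nonneg.mpr h)]
    ring

/-- Convexity of |x|^p: Young's inequality with conjugate exponents, applied to |x|^(p-1) and |y|,
is exactly the statement that the graph lies above its tangents. -/
theorem abs_rpow_ge_tangent {p : ℝ} (hp : 1 < p) (x y : ℝ) :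
    |x| ^ p + p * phi p x * (y - x) ≤ |y| ^ p := by
  have hq := Real.HolderConjugate.conjExponent hp
  have h1 := Real.young_inequality_of_nonneg (Real.rpow_nonneg (abs_nonneg x) (p - 1))
    (abs_nonneg y) hq.symm
  have h2 : (|x| ^ (p - 1)) ^ (Real.conjExponent p) = |x| ^ p := by
    rw [← Real.rpow_mul (abs_nonneg x)]; congr 1
    rw [Real.conjExponent]; field_simp [show p - 1 ≠ 0 by linarith]
  rw [h2] at h1
  have h3 : phi p x * y ≤ |x| ^ (p - 1) * |y| := by
    rw [← abs_phi hp, ← abs_mul]; exact le_abs_self _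
  have h4 := phi_mul_self hp x
  have h5 : |x| ^ p / Real.conjExponent p = |x| ^ p * (1 - 1 / p) := by
    rw [Real.conjExponent]; field_simp [show p - 1 ≠ 0 by linarith]
  rw [h5] at h1
  have hp0 : 0 < p := by linarith
  have h6 : p * (phi p x * y) ≤ p * (|x| ^ p * (1 - 1 / p) + |y| ^ p / p) :=
    mul_le_mul_of_nonneg_left (h3.trans h1) hp0.le
  have h7 : p * (|x| ^ p * (1 - 1 / p) + |y| ^ p / p) = |x| ^ p * (p - 1) + |y| ^ p := by
    field_simp
  have h8 : p * phi p x * (y - x) = p * (phi p x * y) - p * (phi p x * x) := by ring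
  rw [h8, h4]; linarith

/-- The tangent at a - h, evaluated at a, gives an upper bound with slope `phi p (a - h)`; replacing
it by the slope at a costs the last term. -/
theorem abs_sub_rpow_le {p : ℝ} (hp : 1 < p) (a h : ℝ) :
    |a - h| ^ p ≤ |a| ^ p - p * phi p a * h + p * |h| * |phi p a - phi p (a - h)| := by
  have h1 := abs_rpow_ge_tangent hp (a - h) a
  have h2 : h * (phi p a - phi p (a - h)) ≤ |h| * |phi p a - phi p (a - h)| := by
    rw [← abs_mul]; exact le_abs_self _
  have h3 := mul_le_mul_of_nonneg_left h2 (show 0 ≤ p by linarith)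
  have h4 : p * phi p (a - h) * (a - (a - h)) = p * phi p (a - h) * h := by ring
  rw [h4] at h1
  linarith

/-- A difference estimate for `phi` follows from its cases `0 ≤ b ≤ a` and `b ≤ 0 ≤ a`. -/
theorem phi_sub_le_of_cases {p : ℝ} (hp : 1 < p) (B : ℝ → ℝ → ℝ) (hsymm : ∀ a b, B a b = B b a)
    (hneg : ∀ a b, B (-a) (-b) = B a b)
    (h1 : ∀ a b, 0 ≤ b → b ≤ a → a ^ (p - 1) - b ^ (p - 1) ≤ B a b)
    (h2 : ∀ a b, 0 ≤ a → 0 ≤ b → a ^ (p - 1) + b ^ (p - 1) ≤ B a (-b)) (a b : ℝ) :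
    |phi p a - phi p b| ≤ B a b := by
  wlog hab : b ≤ a generalizing a b
  · rw [abs_sub_comm, hsymm]; exact this b a (le_of_not_ge hab)
  rw [abs_of_nonneg (sub_nonneg.mpr (phi_mono hp hab))]
  rcases le_total 0 b with hb | hb
  · rw [phi_of_nonneg p hb, phi_of_nonneg p (hb.trans hab)]; exact h1 a b hb hab
  · rcases le_total 0 a with ha | ha
    · rw [phi_of_nonneg p ha, phi_of_nonpos hp hb]
      have := h2 a (-b) ha (by linarith)
      rw [neg_neg] at this; linarith
    · rw [phi_of_nonpos hp ha, phi_of_nonpos hp hb, ← hneg, hsymm]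
      have := h1 (-b) (-a) (by linarith) (by linarith)
      linarith

/-- For exponent p - 1 ≤ 1 the power is subadditive, so its odd extension is Hölder continuous. No
term of second order in h will appear, which is why p ≤ 2 needs no weights. -/
theorem abs_phi_sub_le_of_le_two {p : ℝ} (hp : 1 < p) (hp2 : p ≤ 2) (a b : ℝ) :
    |phi p a - phi p b| ≤ 2 * |a - b| ^ (p - 1) := by
  have hr : 0 ≤ p - 1 := by linarith
  refine phi_sub_le_of_cases hp (fun a b => 2 * |a - b| ^ (p - 1)) (fun a b => ?_)
    (fun a b => ?_) (fun a b hb hab => ?_) (fun a b ha hb => ?_) a b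
  · simp only [abs_sub_comm]
  · simp only [neg_sub_neg, abs_sub_comm]
  · have h := Real.rpow_add_le_add_rpow (sub_nonneg.mpr hab) hb hr (by linarith)
    rw [sub_add_cancel] at h
    have h0 := Real.rpow_nonneg (sub_nonneg.mpr hab) (p - 1)
    simp only [abs_of_nonneg (sub_nonneg.mpr hab)]
    linarith
  · simp only [sub_neg_eq_add, abs_of_nonneg (add_nonneg ha hb)]
    have h1 := Real.rpow_le_rpow ha (show a ≤ a + b by linarith) hr
    have h2 := Real.rpow_le_rpow hb (show b ≤ a + b by linarith) hr
    linarith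

theorem rpow_sub_rpow_le {r : ℝ} (hr : 1 ≤ r) {a b : ℝ} (hb : 0 ≤ b) (hab : b ≤ a) :
    a ^ r - b ^ r ≤ r * (a - b) * a ^ (r - 1) := by
  rcases hr.eq_or_lt with rfl | hr
  · simp
  · have h := abs_rpow_ge_tangent hr a b
    rw [abs_of_nonneg hb, abs_of_nonneg (hb.trans hab), phi_of_nonneg _ (hb.trans hab)] at h
    linarith

theorem abs_phi_sub_le_of_two_le {p : ℝ} (hp2 : 2 ≤ p) (a b : ℝ) :
    |phi p a - phi p b| ≤ p * |a - b| * (max |a| |b|) ^ (p - 2) := by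
  have hp : 1 < p := by linarith
  refine phi_sub_le_of_cases hp (fun a b => p * |a - b| * (max |a| |b|) ^ (p - 2)) (fun a b => ?_)
    (fun a b => ?_) (fun a b hb hab => ?_) (fun a b ha hb => ?_) a b
  · simp only [abs_sub_comm, max_comm]
  · simp only [neg_sub_neg, abs_sub_comm, abs_neg]
  · have ha := hb.trans hab
    simp only [abs_of_nonneg (sub_nonneg.mpr hab), abs_of_nonneg ha, abs_of_nonneg hb,
      max_eq_left hab]
    have h := rpow_sub_rpow_le (r := p - 1) (by linarith) hb hab
    rw [show p - 1 - 1 = p - 2 by ring] at h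
    have h0 := mul_nonneg (sub_nonneg.mpr hab) (Real.rpow_nonneg ha (p - 2))
    linarith
  · simp only [sub_neg_eq_add, abs_neg, abs_of_nonneg (add_nonneg ha hb), abs_of_nonneg ha,
      abs_of_nonneg hb]
    have key : ∀ x, 0 ≤ x → x ≤ max a b → x ^ (p - 1) ≤ x * (max a b) ^ (p - 2) := by
      intro x hx hxm
      have := Real.rpow_add_one' hx (y := p - 2) (by linarith)
      rw [show p - 2 + 1 = p - 1 by ring] at this
      rw [this, mul_comm]
      exact mul_le_mul_of_nonneg_left (Real.rpow_le_rpow hx hxm (by linarith)) hx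
    have h1 := key a ha (le_max_left _ _)
    have h2 := key b hb (le_max_right _ _)
    have h3 : 0 ≤ (a + b) * (max a b) ^ (p - 2) :=
      mul_nonneg (add_nonneg ha hb) (Real.rpow_nonneg (ha.trans (le_max_left _ _)) _)
    nlinarith

theorem abs_sub_rpow_le_of_le_two {p : ℝ} (hp : 1 < p) (hp2 : p ≤ 2) (a h : ℝ) :
    |a - h| ^ p ≤ |a| ^ p - p * phi p a * h + 2 * p * |h| ^ p := by
  have h1 := abs_sub_rpow_le hp a h
  have h2 := abs_phi_sub_le_of_le_two hp hp2 a (a - h)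
  rw [sub_sub_cancel] at h2
  have h3 := mul_le_mul_of_nonneg_left h2 (show 0 ≤ p * |h| by positivity)
  have h4 := rpow_sub_one_mul_self hp (abs_nonneg h)
  have h5 : p * |h| * (2 * |h| ^ (p - 1)) = 2 * p * |h| ^ p := by rw [← h4]; ring
  linarith

theorem abs_sub_rpow_le_of_two_le {p : ℝ} (hp2 : 2 ≤ p) (a h : ℝ) :
    |a - h| ^ p ≤ |a| ^ p - p * phi p a * h +
      p ^ 2 * 2 ^ (p - 2) * (|h| ^ 2 * |a| ^ (p - 2) + |h| ^ p) := by
  have hp : 1 < p := by linarith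
  have h1 := abs_sub_rpow_le hp a h
  have h2 := abs_phi_sub_le_of_two_le hp2 a (a - h)
  rw [sub_sub_cancel] at h2
  have h3 := mul_le_mul_of_nonneg_left h2 (show 0 ≤ p * |h| by positivity)
  -- The difference estimate involves max(|a|, |a - h|); bounding it by 2 max(|a|, |h|) separates
  -- the quadratic error h²|a|^(p-2) from the pure power |h|^p.
  have hm : max |a| |a - h| ≤ 2 * max |a| |h| := by
    have := abs_sub a h
    have h5 := le_max_left |a| |h|
    have h6 := le_max_right |a| |h|
    exact max_le (by linarith [abs_nonneg a]) (by linarith)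
  have h4 : (max |a| |a - h|) ^ (p - 2) ≤ 2 ^ (p - 2) * (|a| ^ (p - 2) + |h| ^ (p - 2)) := by
    refine (Real.rpow_le_rpow (le_max_of_le_left (abs_nonneg a)) hm (by linarith)).trans ?_
    rw [Real.mul_rpow (by norm_num) (le_max_of_le_left (abs_nonneg a))]
    refine mul_le_mul_of_nonneg_left ?_ (by positivity)
    rcases max_cases |a| |h| with ⟨hmax, _⟩ | ⟨hmax, _⟩ <;> rw [hmax]
    · linarith [Real.rpow_nonneg (abs_nonneg h) (p - 2)]
    · linarith [Real.rpow_nonneg (abs_nonneg a) (p - 2)]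
  have h5 : |h| ^ 2 * |h| ^ (p - 2) = |h| ^ p := by
    rw [← Real.rpow_natCast, ← Real.rpow_add_of_nonneg (abs_nonneg h) (by norm_num) (by linarith)]
    congr 1; push_cast; ring
  have h6 := mul_le_mul_of_nonneg_left h4 (show 0 ≤ p * |h| * (p * |h|) by positivity)
  rw [← h5]
  nlinarith

/-! ### Locating the minimizer by the sign of the p-Laplacian -/

section Dynamics

variable {V : Type*} [Fintype V]

open scoped Classical in
/-- The graph `p`-Laplacian with the value at `v` replaced by `y`. -/
noncomputable def flux (p : ℝ) (G : SimpleGraph V) (f : V → ℝ) (v : V) (y : ℝ) : ℝ :=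
  ∑ w ∈ G.neighborFinset v, phi p (f w - y)

theorem localSum_ge_tangent {p : ℝ} (hp : 1 < p) (G : SimpleGraph V) (f : V → ℝ) (v : V)
    (y z : ℝ) : localSum p G f v y + p * flux p G f v y * (y - z) ≤ localSum p G f v z := by
  unfold localSum flux
  rw [Finset.mul_sum, Finset.sum_mul, ← Finset.sum_add_distrib]
  refine Finset.sum_le_sum fun w _ => ?_
  have := abs_rpow_ge_tangent hp (f w - y) (f w - z)
  rwa [show f w - z - (f w - y) = y - z by ring] at this

/-- If the minimizer lay above y, the tangent inequality at y would make y a minimizer too, against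
uniqueness. This and its mirror image are the only comparison principle needed. -/
theorem argmin_le {p : ℝ} (hp : 1 < p) (G : SimpleGraph V) (f : V → ℝ) {v w : V}
    (hvw : G.Adj v w) {y : ℝ} (hy : flux p G f v y ≤ 0) : argmin p G f v ≤ y := by
  by_contra! hlt
  have h1 := localSum_ge_tangent hp G f v y (argmin p G f v)
  have h2 : 0 ≤ p * flux p G f v y * (y - argmin p G f v) :=
    mul_nonneg_of_nonpos_of_nonpos (mul_nonpos_of_nonneg_of_nonpos (by linarith) hy) (by linarith)
  have h3 := eq_argmin hp G f hvw (y := y) fun z => by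
    linarith [localSum_argmin_le hp G f v z]
  linarith

theorem le_argmin {p : ℝ} (hp : 1 < p) (G : SimpleGraph V) (f : V → ℝ) {v w : V}
    (hvw : G.Adj v w) {y : ℝ} (hy : 0 ≤ flux p G f v y) : y ≤ argmin p G f v := by
  by_contra! hlt
  have h1 := localSum_ge_tangent hp G f v y (argmin p G f v)
  have h2 : 0 ≤ p * flux p G f v y * (y - argmin p G f v) :=
    mul_nonneg (mul_nonneg (by linarith) hy) (by linarith)
  have h3 := eq_argmin hp G f hvw (y := y) fun z => by
    linarith [localSum_argmin_le hp G f v z]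
  linarith

theorem step_self (p : ℝ) (G : SimpleGraph V) (f : V → ℝ) (v : V) :
    step p G f v v = argmin p G f v := if_pos rfl

theorem step_of_ne (p : ℝ) (G : SimpleGraph V) (f : V → ℝ) {u v : V} (h : u ≠ v) :
    step p G f v u = f u := if_neg h

end Dynamics

end LpConsensus

/-! ### Energy decrement of one update and its relation to the p-Laplacian -/

namespace LpConsensus

section Energy

variable {V : Type*} [Fintype V]

open scoped Classical in
theorem sum_neighborFinset_eq (G : SimpleGraph V) (v : V) (g : V → ℝ) :
    ∑ w ∈ G.neighborFinset v, g w = ∑ w, if G.Adj v w then g w else 0 := by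
  rw [← Finset.sum_filter]
  refine Finset.sum_congr ?_ fun _ _ => rfl
  ext w; simp

open scoped Classical in
theorem sum_neighborFinset_comm (G : SimpleGraph V) (g : V → V → ℝ) :
    ∑ v, ∑ w ∈ G.neighborFinset v, g v w = ∑ v, ∑ w ∈ G.neighborFinset v, g w v := by
  simp only [sum_neighborFinset_eq]
  rw [Finset.sum_comm]
  simp only [G.adj_comm]

open scoped Classical in
-- Every unordered edge is the image of exactly two ordered adjacent pairs.
theorem two_mul_sum_edgeFinset (G : SimpleGraph V) (g : V → V → ℝ) (hg : ∀ u v, g u v = g v u) :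
    2 * ∑ e ∈ G.edgeFinset, Sym2.lift ⟨g, hg⟩ e = ∑ v, ∑ w ∈ G.neighborFinset v, g v w := by
  have h1 : ∑ v, ∑ w ∈ G.neighborFinset v, g v w =
      ∑ x : V × V with G.Adj x.1 x.2, Sym2.lift ⟨g, hg⟩ s(x.1, x.2) := by
    simp only [sum_neighborFinset_eq, Sym2.lift_mk, Finset.sum_filter]
    rw [Fintype.sum_prod_type]
  rw [h1, ← Finset.sum_fiberwise_of_maps_to (s := Finset.univ.filter fun x : V × V => G.Adj x.1 x.2)
    (t := G.edgeFinset) (g := fun x : V × V => s(x.1, x.2)) (fun x hx => by simpa using hx),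
    Finset.mul_sum]
  refine Finset.sum_congr rfl fun e he => ?_
  induction e with | _ a b =>
  have hab : G.Adj a b := by simpa using he
  have h2 : (Finset.univ.filter fun x : V × V => G.Adj x.1 x.2).filter
      (fun x => s(x.1, x.2) = s(a, b)) = {(a, b), (b, a)} := by
    ext ⟨x, y⟩
    simp only [Finset.mem_filter, Finset.mem_univ, true_and, Sym2.eq_iff, Finset.mem_insert,
      Finset.mem_singleton, Prod.mk.injEq]
    constructor
    · exact fun h => h.2
    · rintro (⟨rfl, rfl⟩ | ⟨rfl, rfl⟩)
      · exact ⟨hab, Or.inl ⟨rfl, rfl⟩⟩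
      · exact ⟨hab.symm, Or.inr ⟨rfl, rfl⟩⟩
  rw [h2, Finset.sum_pair (by simp [hab.ne])]
  simp only [Sym2.lift_mk, hg b a]
  ring

theorem two_mul_energy (p : ℝ) (G : SimpleGraph V) (f : V → ℝ) :
    2 * energy p G f = ∑ v, localSum p G f v (f v) := by
  unfold energy localSum
  rw [two_mul_sum_edgeFinset]
  exact Finset.sum_congr rfl fun v _ => Finset.sum_congr rfl fun w _ => by rw [abs_sub_comm]

theorem energy_nonneg (p : ℝ) (G : SimpleGraph V) (f : V → ℝ) : 0 ≤ energy p G f := by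
  have h := two_mul_energy p G f
  have : 0 ≤ ∑ v, localSum p G f v (f v) := Finset.sum_nonneg fun v _ =>
    Finset.sum_nonneg fun w _ => Real.rpow_nonneg (abs_nonneg _) _
  linarith

open scoped Classical in
theorem sum_sum_eq_two_mul_of_support (g : V → V → ℝ) (v : V) (hg : ∀ u w, g u w = g w u)
    (h0 : ∀ u w, u ≠ v → w ≠ v → g u w = 0) (hv : g v v = 0) :
    ∑ u, ∑ w, g u w = 2 * ∑ w, g v w := by
  have h : ∀ u w, g u w = (if u = v then g v w else 0) + if w = v then g v u else 0 := by
    intro u w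
    by_cases hu : u = v <;> by_cases hw : w = v
    · simp [hu, hw, hv]
    · simp [hu, hw]
    · simp [hu, hw, hg u v]
    · simp [hu, hw, h0 u w hu hw]
  rw [Finset.sum_congr rfl fun u _ => Finset.sum_congr rfl fun w _ => h u w]
  simp only [Finset.sum_add_distrib]
  rw [Finset.sum_comm]
  simp only [Finset.sum_ite_eq', Finset.mem_univ, if_true]
  ring

/-- Only edges at v change, so the difference of the two double sums lives on the row and the column
of v, which are equal by symmetry. -/
theorem energy_sub_energy_step (p : ℝ) (G : SimpleGraph V) (f : V → ℝ) (v : V) :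
    energy p G f - energy p G (step p G f v) =
      localSum p G f v (f v) - localSum p G f v (argmin p G f v) := by
  classical
  set f' := step p G f v with hf'
  have h1 := two_mul_energy p G f
  have h2 := two_mul_energy p G f'
  unfold localSum at h1 h2 ⊢
  simp only [sum_neighborFinset_eq] at h1 h2 ⊢
  have h3 := sum_sum_eq_two_mul_of_support
    (fun u w => (if G.Adj u w then |f w - f u| ^ p else 0) -
      if G.Adj u w then |f' w - f' u| ^ p else 0) v
    (fun u w => congrArg₂ _ (if_congr (G.adj_comm u w) (by rw [abs_sub_comm]) rfl)
      (if_congr (G.adj_comm u w) (by rw [abs_sub_comm]) rfl))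
    (fun u w hu hw => by simp only [hf', step_of_ne p G f hu, step_of_ne p G f hw, sub_self])
    (by simp)
  simp only [Finset.sum_sub_distrib] at h3
  have h4 : ∑ w, (if G.Adj v w then |f' w - f' v| ^ p else 0) =
      ∑ w, if G.Adj v w then |f w - argmin p G f v| ^ p else 0 := by
    refine Finset.sum_congr rfl fun w _ => ?_
    split_ifs with h
    · rw [hf', step_of_ne p G f h.ne', step_self]
    · rfl
  rw [h4] at h3
  linarith

theorem localSum_sub_le_drop {p : ℝ} (hp : 1 < p) (G : SimpleGraph V) (f : V → ℝ) (v : V) (y : ℝ) :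
    localSum p G f v (f v) - localSum p G f v y ≤ energy p G f - energy p G (step p G f v) := by
  rw [energy_sub_energy_step]
  linarith [localSum_argmin_le hp G f v y]

theorem energy_step_le {p : ℝ} (hp : 1 < p) (G : SimpleGraph V) (f : V → ℝ) (v : V) :
    energy p G (step p G f v) ≤ energy p G f := by
  linarith [localSum_sub_le_drop hp G f v (f v)]

open scoped Classical in
/-- The total of a weight `a` of the increments along the edges at `v`. -/
noncomputable def weightSum (a : ℝ → ℝ) (G : SimpleGraph V) (f : V → ℝ) (v : V) : ℝ :=
  ∑ w ∈ G.neighborFinset v, a (f w - f v)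

/-- A bound for the error in the first order expansion of `|x| ^ p`. -/
def ExpansionBound (p K : ℝ) (a : ℝ → ℝ) : Prop :=
  ∀ x h, |x - h| ^ p ≤ |x| ^ p - p * phi p x * h + K * (|h| ^ 2 * a x + |h| ^ p)

theorem localSum_add_le {p K : ℝ} (hK : 0 ≤ K) {a : ℝ → ℝ}
    (H : ExpansionBound p K a) (G : SimpleGraph V) (f : V → ℝ) (v : V) (h : ℝ) :
    localSum p G f v (f v + h) ≤ localSum p G f v (f v) - p * flux p G f v (f v) * h +
      K * (|h| ^ 2 * weightSum a G f v + Fintype.card V * |h| ^ p) := by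
  classical
  have h1 : localSum p G f v (f v + h) ≤ ∑ w ∈ G.neighborFinset v,
      (|f w - f v| ^ p - p * phi p (f w - f v) * h +
        K * (|h| ^ 2 * a (f w - f v) + |h| ^ p)) := by
    unfold localSum
    refine Finset.sum_le_sum fun w _ => ?_
    rw [← sub_sub]; exact H _ _
  -- The degree is estimated crudely by the number of vertices; this is the source of the factor n
  -- in the error term.
  have h2 : (((G.neighborFinset v).card : ℕ) : ℝ) ≤ Fintype.card V := by
    exact_mod_cast Finset.card_le_univ _
  have h3 := mul_le_mul_of_nonneg_left
    (mul_le_mul_of_nonneg_right h2 (Real.rpow_nonneg (abs_nonneg h) p)) hK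
  simp only [Finset.sum_add_distrib, Finset.sum_sub_distrib, ← Finset.mul_sum, ← Finset.sum_mul,
    Finset.sum_const, nsmul_eq_mul] at h1
  unfold weightSum flux
  unfold localSum at h1 ⊢
  simp only [sum_neighborFinset_eq] at *
  linarith

/-- A shift of size h in the direction of the flux D gains at least |D|h to first order. The two
errors are each at most |D|h/4 if h is below (|D|/(4Kn))^(1/(p-1)) and below |D|/(4KA); taking h
equal to the smaller of these bounds gives the two alternatives. -/
theorem flux_le_of_drop {p K : ℝ} (hp : 1 < p) (hK : 0 < K) {a : ℝ → ℝ} (ha : ∀ x, 0 ≤ a x)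
    (H : ExpansionBound p K a) (G : SimpleGraph V) (f : V → ℝ) (v : V) :
    |flux p G f v (f v)| * (|flux p G f v (f v)| / (4 * K * Fintype.card V)) ^ (p - 1)⁻¹ ≤
        2 * (energy p G f - energy p G (step p G f v)) ∨
      flux p G f v (f v) ^ 2 ≤
        8 * K * (energy p G f - energy p G (step p G f v)) * weightSum a G f v := by
  set D := flux p G f v (f v) with hD
  set Δ := energy p G f - energy p G (step p G f v) with hΔ
  set A := weightSum a G f v with hA
  set n : ℝ := (Fintype.card V : ℝ) with hn
  have hn0 : 0 < n := by
    rw [hn]; exact Nat.cast_pos.mpr (Fintype.card_pos_iff.mpr ⟨v⟩)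
  have hA0 : 0 ≤ A := Finset.sum_nonneg fun _ _ => ha _
  set h1 := (|D| / (4 * K * n)) ^ (p - 1)⁻¹ with hh1
  have h10 : 0 ≤ h1 := by positivity
  have h1p : h1 ^ (p - 1) = |D| / (4 * K * n) :=
    Real.rpow_inv_rpow (by positivity) (by linarith)
  have main : ∀ h, 0 ≤ h → h ≤ h1 → 4 * K * (h * A) ≤ |D| → |D| * h ≤ 2 * Δ := by
    intro h hh hle hhA
    have e1 : h ^ (p - 1) ≤ |D| / (4 * K * n) := by
      rw [← h1p]; exact Real.rpow_le_rpow hh hle (by linarith)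
    have e2 : 4 * (K * (n * h ^ p)) ≤ |D| * h := by
      rw [← rpow_sub_one_mul_self hp hh]
      rw [le_div_iff₀ (by positivity)] at e1
      nlinarith
    have e3 : 4 * (K * (h ^ 2 * A)) ≤ |D| * h := by nlinarith
    have e4 : ∃ s : ℝ, |s| = h ∧ D * s = |D| * h := by
      rcases le_total 0 D with hd | hd
      · exact ⟨h, abs_of_nonneg hh, by rw [abs_of_nonneg hd]⟩
      · exact ⟨-h, by rw [abs_neg, abs_of_nonneg hh], by rw [abs_of_nonpos hd]; ring⟩
    obtain ⟨s, hs, hDs⟩ := e4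
    have e5 := localSum_add_le hK.le H G f v s
    rw [hs, ← hD, mul_assoc p, hDs, ← hA, ← hn] at e5
    have e6 := localSum_sub_le_drop hp G f v (f v + s)
    have e7 : |D| * h ≤ p * (|D| * h) := le_mul_of_one_le_left (by positivity) hp.le
    linarith
  by_cases hcase : 4 * K * (h1 * A) ≤ |D|
  · left
    exact main h1 h10 le_rfl hcase
  · right
    push Not at hcase
    have hAp : 0 < A := by
      rcases hA0.eq_or_lt with h | h
      · rw [← h] at hcase; simp only [mul_zero] at hcase
        exact absurd hcase (not_lt.mpr (abs_nonneg D))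
      · exact h
    have hx := main (|D| / (4 * K * A)) (by positivity)
      (by rw [div_le_iff₀ (by positivity)]; linarith) (by field_simp; rfl)
    rw [← sq_abs D]
    rw [mul_div_assoc', div_le_iff₀ (by positivity)] at hx
    nlinarith

theorem total_flux_le_of_drop {p K : ℝ} (hp : 1 < p) (hK : 0 < K) {a : ℝ → ℝ} (ha : ∀ x, 0 ≤ a x)
    (H : ExpansionBound p K a) (G : SimpleGraph V) (f : V → ℝ) :
    ((∑ v, |flux p G f v (f v)|) / 2) ^ (p / (p - 1)) ≤
        2 * (4 * K) ^ (p - 1)⁻¹ * (Fintype.card V : ℝ) ^ (2 / (p - 1)) *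
          ∑ v, (energy p G f - energy p G (step p G f v)) ∨
      ((∑ v, |flux p G f v (f v)|) / 2) ^ 2 ≤
        8 * K * (∑ v, (energy p G f - energy p G (step p G f v))) * ∑ v, weightSum a G f v := by
  classical
  set D := fun v => |flux p G f v (f v)| with hD
  set Δ := fun v => energy p G f - energy p G (step p G f v) with hΔ
  have hΔ0 : ∀ v, 0 ≤ Δ v := fun v => sub_nonneg.mpr (energy_step_le hp G f v)
  have hA0 : ∀ v, 0 ≤ weightSum a G f v := fun v => Finset.sum_nonneg fun _ _ => ha _
  have hD0 : ∀ v, 0 ≤ D v := fun v => abs_nonneg _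
  set n : ℝ := (Fintype.card V : ℝ) with hn
  have hn0 : 0 ≤ n := by positivity
  -- Vertices are sorted by which alternative of the single vertex estimate holds; one of the two
  -- classes carries at least half of the total flux.
  let P : V → Prop := fun v => D v * (D v / (4 * K * n)) ^ (p - 1)⁻¹ ≤ 2 * Δ v
  have hp1 : 0 < p - 1 := by linarith
  have hq : p / (p - 1) = 1 + (p - 1)⁻¹ := by field_simp; ring
  set x := fun v => if P v then D v else 0 with hx
  set y := fun v => if P v then 0 else D v with hy
  have hxy : ∑ v, D v = ∑ v, x v + ∑ v, y v := by
    rw [← Finset.sum_add_distrib]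
    refine Finset.sum_congr rfl fun v _ => ?_
    simp only [hx, hy]; split_ifs <;> simp
  have hx0 : ∀ v, 0 ≤ x v := fun v => by simp only [hx]; split_ifs; exacts [hD0 v, le_rfl]
  have hy0 : ∀ v, 0 ≤ y v := fun v => by simp only [hy]; split_ifs; exacts [le_rfl, hD0 v]
  have hT : 0 ≤ ∑ v, D v := Finset.sum_nonneg fun v _ => hD0 v
  have hx1 : ∀ v, x v ^ (p / (p - 1)) ≤ 2 * (4 * K * n) ^ (p - 1)⁻¹ * Δ v := by
    intro v
    by_cases hPv : P v
    · simp only [hx, if_pos hPv]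
      have h1 : D v * (D v / (4 * K * n)) ^ (p - 1)⁻¹ ≤ 2 * Δ v := hPv
      have hn1 : 0 < n := by
        rw [hn]; exact Nat.cast_pos.mpr (Fintype.card_pos_iff.mpr ⟨v⟩)
      rw [Real.div_rpow (hD0 v) (by positivity), mul_div_assoc', div_le_iff₀ (by positivity)] at h1
      rw [hq, Real.rpow_add_of_nonneg (hD0 v) (by norm_num) (by positivity), Real.rpow_one]
      linarith
    · simp only [hx, if_neg hPv]
      rw [Real.zero_rpow (by positivity)]
      exact mul_nonneg (by positivity) (hΔ0 v)
  have hy1 : ∀ v, y v ^ 2 ≤ 8 * K * Δ v * weightSum a G f v := by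
    intro v
    by_cases hPv : P v
    · simp only [hy, if_pos hPv]
      have := mul_nonneg (mul_nonneg (show 0 ≤ 8 * K by positivity) (hΔ0 v)) (hA0 v)
      simpa using this
    · simp only [hy, if_neg hPv, hD, sq_abs]
      exact (flux_le_of_drop hp hK ha H G f v).resolve_left hPv
  rcases le_total (∑ v, y v) (∑ v, x v) with h | h
  · left
    have h1 : (∑ v, D v) / 2 ≤ ∑ v, x v := by linarith
    refine (Real.rpow_le_rpow (by positivity) h1 (by positivity)).trans ?_
    -- The power mean inequality costs n^(1/(p-1)); together with the factor from the degree bound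
    -- this makes n^(2/(p-1)).
    have h2 := Real.rpow_sum_le_const_mul_sum_rpow_of_nonneg (s := Finset.univ) (f := x)
      (p := p / (p - 1)) (by rw [hq]; linarith [inv_pos.mpr hp1]) (fun v _ => hx0 v)
    refine h2.trans ?_
    have h3 : ∑ v, x v ^ (p / (p - 1)) ≤ 2 * (4 * K * n) ^ (p - 1)⁻¹ * ∑ v, Δ v := by
      rw [Finset.mul_sum]; exact Finset.sum_le_sum fun v _ => hx1 v
    rw [Finset.card_univ, ← hn, hq, add_sub_cancel_left]
    refine (mul_le_mul_of_nonneg_left (hq ▸ h3) (by positivity)).trans (le_of_eq ?_)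
    rw [Real.mul_rpow (by positivity) hn0, show 2 / (p - 1) = (p - 1)⁻¹ + (p - 1)⁻¹ by ring,
      Real.rpow_add_of_nonneg hn0 (by positivity) (by positivity)]
    ring
  · right
    have h1 : (∑ v, D v) / 2 ≤ ∑ v, y v := by linarith
    refine (pow_le_pow_left₀ (by positivity) h1 2).trans ?_
    -- Cauchy-Schwarz on the class where D² ≤ 8KΔA.
    have := Finset.sum_sq_le_sum_mul_sum_of_sq_le_mul Finset.univ
      (r := y) (f := fun v => 8 * K * Δ v) (g := fun v => weightSum a G f v)
      (fun v _ => mul_nonneg (by positivity) (hΔ0 v)) (fun v _ => hA0 v) (fun v _ => hy1 v)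
    rwa [← Finset.mul_sum] at this

end Energy

end LpConsensus

/-! ### Flow through cuts, and the energy in terms of the total flux -/

namespace LpConsensus

section Flux

variable {V : Type*} [Fintype V]

/-- Ranks refine the order by value and break ties. Injectivity later allows edges with a common
lower endpoint to be counted by the ranks of their upper endpoints. -/
theorem exists_rank (f : V → ℝ) : ∃ r : V → ℕ, Function.Injective r ∧
    (∀ v, r v < Fintype.card V) ∧ ∀ u v, r u ≤ r v → f u ≤ f v := by
  let e := Fintype.equivFin V
  let σ := Tuple.sort (f ∘ e.symm)
  refine ⟨fun v => (σ.symm (e v) : ℕ), fun u v h => ?_, fun v => Fin.is_lt _, fun u v h => ?_⟩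
  · exact e.injective (σ.symm.injective (Fin.ext h))
  · have := Tuple.monotone_sort (f ∘ e.symm) (show σ.symm (e u) ≤ σ.symm (e v) from h)
    simpa [σ] using this

/-- The `ℓ¹` norm of the graph `p`-Laplacian. -/
noncomputable def totalFlux (p : ℝ) (G : SimpleGraph V) (f : V → ℝ) : ℝ :=
  ∑ v, |flux p G f v (f v)|

theorem totalFlux_nonneg (p : ℝ) (G : SimpleGraph V) (f : V → ℝ) : 0 ≤ totalFlux p G f :=
  Finset.sum_nonneg fun _ _ => abs_nonneg _

open scoped Classical in
/-- The flow of `phi` through a cut is at most the total flux. -/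
theorem cut_flux_le {p : ℝ} (hp : 1 < p) (G : SimpleGraph V) (f : V → ℝ) (S : Finset V) :
    ∑ u ∈ S, ∑ w ∈ Sᶜ, (if G.Adj u w then phi p (f w - f u) else 0) ≤ totalFlux p G f := by
  -- Internal edges cancel because `phi` is odd, so the sum of the fluxes over S is the flow leaving
  -- S.
  have h1 : ∑ u ∈ S, ∑ w ∈ S, (if G.Adj u w then phi p (f w - f u) else 0) = 0 := by
    have h2 : ∑ u ∈ S, ∑ w ∈ S, (if G.Adj u w then phi p (f w - f u) else 0) =
        ∑ u ∈ S, ∑ w ∈ S, -(if G.Adj u w then phi p (f w - f u) else 0) := by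
      rw [Finset.sum_comm]
      refine Finset.sum_congr rfl fun u _ => Finset.sum_congr rfl fun w _ => ?_
      rw [← neg_sub (f w) (f u), phi_neg hp]
      by_cases h : G.Adj u w
      · simp [h, h.symm]
      · simp [h, mt SimpleGraph.Adj.symm h]
    simp only [Finset.sum_neg_distrib] at h2
    linarith
  have h2 : ∑ u ∈ S, flux p G f u (f u) =
      ∑ u ∈ S, ∑ w ∈ Sᶜ, (if G.Adj u w then phi p (f w - f u) else 0) := by
    have h3 : ∀ u, flux p G f u (f u) = ∑ w ∈ S, (if G.Adj u w then phi p (f w - f u) else 0) +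
        ∑ w ∈ Sᶜ, (if G.Adj u w then phi p (f w - f u) else 0) := by
      intro u
      rw [Finset.sum_add_sum_compl]
      unfold flux
      rw [sum_neighborFinset_eq]
    simp only [h3, Finset.sum_add_distrib, h1, zero_add]
  rw [← h2]
  exact (Finset.sum_le_sum fun u _ => le_abs_self _).trans
    (Finset.sum_le_univ_sum_of_nonneg fun u => abs_nonneg _)

/-- The edge crosses the level cut {f ≤ f u}, through which all contributions are nonnegative, so
none of them exceeds the whole flow. -/
theorem edge_flux_le {p : ℝ} (hp : 1 < p) (G : SimpleGraph V) (f : V → ℝ) {u w : V}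
    (h : G.Adj u w) : |f w - f u| ^ (p - 1) ≤ totalFlux p G f := by
  classical
  wlog hlt : f u < f w generalizing u w
  · rcases (not_lt.mp hlt).lt_or_eq with h1 | h1
    · rw [abs_sub_comm]; exact this h.symm h1
    · rw [h1, sub_self, abs_zero, Real.zero_rpow (by linarith)]
      exact totalFlux_nonneg p G f
  refine le_trans ?_ (cut_flux_le hp G f (Finset.univ.filter fun v => f v ≤ f u))
  have hnn : ∀ a ∈ Finset.univ.filter (fun v => f v ≤ f u),
      ∀ b ∈ (Finset.univ.filter fun v => f v ≤ f u)ᶜ,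
      0 ≤ (if G.Adj a b then phi p (f b - f a) else 0) := by
    intro a ha b hb
    simp only [Finset.mem_filter, Finset.mem_univ, true_and, Finset.mem_compl, not_le] at ha hb
    split_ifs
    · exact phi_nonneg (by linarith)
    · exact le_rfl
  have hu : u ∈ Finset.univ.filter (fun v => f v ≤ f u) := by simp
  have hw : w ∈ (Finset.univ.filter fun v => f v ≤ f u)ᶜ := by simpa using hlt
  refine le_trans ?_ (Finset.single_le_sum (fun a ha => Finset.sum_nonneg (hnn a ha)) hu)
  refine le_trans (le_of_eq ?_) (Finset.single_le_sum (hnn u hu) hw)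
  have h1 : 0 ≤ f w - f u := by linarith
  rw [if_pos h, phi_of_nonneg p h1, abs_of_nonneg h1]

theorem abs_sub_le_of_edge_bound {G : SimpleGraph V} (hG : G.Connected) {f : V → ℝ} {L : ℝ}
    (hL : 0 ≤ L) (h : ∀ u w, G.Adj u w → |f w - f u| ≤ L) (u v : V) :
    |f v - f u| ≤ Fintype.card V * L := by
  classical
  obtain ⟨P, hP⟩ := (hG.preconnected u v).exists_isPath
  have key : ∀ {a b : V} (P : G.Walk a b), |f b - f a| ≤ P.length * L := by
    intro a b P
    induction P with
    | nil => simp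
    | @cons a c b hac P ih =>
      have h1 := h a c hac
      have h2 := abs_sub_le (f b) (f c) (f a)
      rw [SimpleGraph.Walk.length_cons]
      push_cast
      linarith
  refine (key P).trans (mul_le_mul_of_nonneg_right ?_ hL)
  exact_mod_cast hP.length_lt.le

theorem sum_flux_eq_zero {p : ℝ} (hp : 1 < p) (G : SimpleGraph V) (f : V → ℝ) :
    ∑ v, flux p G f v (f v) = 0 := by
  classical
  have h := sum_neighborFinset_comm G fun v w => phi p (f w - f v)
  have h3 : ∑ v, ∑ w ∈ G.neighborFinset v, phi p (f v - f w) =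
      -∑ v, ∑ w ∈ G.neighborFinset v, phi p (f w - f v) := by
    simp only [← Finset.sum_neg_distrib]
    exact Finset.sum_congr rfl fun v _ => Finset.sum_congr rfl fun w _ => by
      rw [← phi_neg hp, neg_sub]
  unfold flux
  linarith

open scoped Classical in
-- Summation by parts, from `phi p x * x = |x| ^ p` and the oddness of `phi`.
theorem energy_eq_neg_sum {p : ℝ} (hp : 1 < p) (G : SimpleGraph V) (f : V → ℝ) :
    energy p G f = -∑ v, f v * flux p G f v (f v) := by
  have h1 := two_mul_energy p G f
  have h := sum_neighborFinset_comm G fun v w => phi p (f w - f v) * f w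
  have h2 : ∑ v, ∑ w ∈ G.neighborFinset v, phi p (f v - f w) * f v =
      -∑ v, f v * flux p G f v (f v) := by
    unfold flux
    simp only [← Finset.sum_neg_distrib, Finset.mul_sum]
    exact Finset.sum_congr rfl fun v _ => Finset.sum_congr rfl fun w _ => by
      rw [← neg_sub (f w), phi_neg hp]; ring
  have h3 : ∀ v, localSum p G f v (f v) =
      (∑ w ∈ G.neighborFinset v, phi p (f w - f v) * f w) - f v * flux p G f v (f v) := by
    intro v
    unfold localSum flux
    rw [Finset.mul_sum, ← Finset.sum_sub_distrib]
    refine Finset.sum_congr rfl fun w _ => ?_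
    rw [← phi_mul_self hp]; ring
  rw [Finset.sum_congr rfl fun v _ => h3 v, Finset.sum_sub_distrib, h, h2] at h1
  linarith

/-- The fluxes add up to zero, so f may be replaced by f - f u in the summation by parts. -/
theorem energy_le_mul_totalFlux {p : ℝ} (hp : 1 < p) (G : SimpleGraph V) {f : V → ℝ} {M : ℝ}
    (hM : ∀ u v, |f v - f u| ≤ M) (u : V) : energy p G f ≤ M * totalFlux p G f := by
  have h : energy p G f = ∑ v, -((f v - f u) * flux p G f v (f v)) := by
    rw [energy_eq_neg_sum hp]
    simp only [sub_mul, Finset.sum_neg_distrib, Finset.sum_sub_distrib, ← Finset.mul_sum,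
      sum_flux_eq_zero hp]
    ring
  rw [h, totalFlux, Finset.mul_sum]
  refine Finset.sum_le_sum fun v _ => (neg_le_abs _).trans ?_
  rw [abs_mul]
  exact mul_le_mul_of_nonneg_right (hM u v) (abs_nonneg _)

open scoped Classical in
/-- The pairs of adjacent vertices in increasing order of rank. -/
noncomputable def orderedEdges (G : SimpleGraph V) (r : V → ℕ) : Finset (V × V) :=
  Finset.univ.filter fun x => G.Adj x.1 x.2 ∧ r x.1 < r x.2

theorem mem_orderedEdges {G : SimpleGraph V} {r : V → ℕ} {x : V × V} :
    x ∈ orderedEdges G r ↔ G.Adj x.1 x.2 ∧ r x.1 < r x.2 := by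
  simp [orderedEdges]

/-- Layer-cake argument: an edge crosses as many of the cuts {r ≤ k} as its rank difference, there
are n such cuts, and each carries a flow of at most T. -/
theorem sum_rank_mul_le {p : ℝ} (hp : 1 < p) (G : SimpleGraph V) (f : V → ℝ) {r : V → ℕ}
    (hr : ∀ v, r v < Fintype.card V) (hrf : ∀ u v, r u ≤ r v → f u ≤ f v) :
    ∑ x ∈ orderedEdges G r, ((r x.2 : ℝ) - r x.1) * |f x.2 - f x.1| ^ (p - 1) ≤
      Fintype.card V * totalFlux p G f := by
  classical
  set n := Fintype.card V with hn
  have h1 : ∀ k, ∑ x ∈ orderedEdges G r,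
      (if r x.1 ≤ k ∧ k < r x.2 then |f x.2 - f x.1| ^ (p - 1) else 0) ≤ totalFlux p G f := by
    intro k
    refine le_trans (le_of_eq ?_) (cut_flux_le hp G f (Finset.univ.filter fun v => r v ≤ k))
    rw [← Finset.sum_product', ← Finset.sum_filter, ← Finset.sum_filter]
    refine Finset.sum_congr ?_ fun x hx => ?_
    · ext x
      simp only [Finset.mem_filter, mem_orderedEdges, Finset.mem_product, Finset.mem_compl,
        Finset.mem_univ, true_and, not_le]
      constructor
      · rintro ⟨⟨h1, -⟩, h2⟩; exact ⟨h2, h1⟩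
      · rintro ⟨h2, h1⟩; exact ⟨⟨h1, h2.1.trans_lt h2.2⟩, h2⟩
    · simp only [Finset.mem_filter, Finset.mem_product, Finset.mem_compl,
        Finset.mem_univ, true_and, not_le] at hx
      have h0 : 0 ≤ f x.2 - f x.1 := sub_nonneg.mpr (hrf _ _ (by omega))
      rw [phi_of_nonneg p h0, abs_of_nonneg h0]
  have h2 : ∀ x ∈ orderedEdges G r, ((r x.2 : ℝ) - r x.1) * |f x.2 - f x.1| ^ (p - 1) =
      ∑ k ∈ Finset.range n,
        (if r x.1 ≤ k ∧ k < r x.2 then |f x.2 - f x.1| ^ (p - 1) else 0) := by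
    intro x hx
    rw [mem_orderedEdges] at hx
    rw [← Finset.sum_filter, Finset.sum_const, nsmul_eq_mul]
    congr 1
    have : (Finset.range n).filter (fun k => r x.1 ≤ k ∧ k < r x.2) = Finset.Ico (r x.1) (r x.2) := by
      ext k
      simp only [Finset.mem_filter, Finset.mem_range, Finset.mem_Ico]
      have := hr x.2
      omega
    rw [this, Nat.card_Ico, Nat.cast_sub hx.2.le]
  rw [Finset.sum_congr rfl h2, Finset.sum_comm]
  refine (Finset.sum_le_sum fun k _ => h1 k).trans ?_
  simp

theorem sum_weightSum_eq (G : SimpleGraph V) (f : V → ℝ) {r : V → ℕ}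
    (hinj : Function.Injective r) (a : ℝ → ℝ) (ha : ∀ x, a (-x) = a x) :
    ∑ v, weightSum a G f v = 2 * ∑ x ∈ orderedEdges G r, a (f x.2 - f x.1) := by
  classical
  unfold weightSum
  simp only [sum_neighborFinset_eq]
  rw [orderedEdges, Finset.sum_filter, Fintype.sum_prod_type, two_mul]
  nth_rewrite 3 [Finset.sum_comm]
  simp only [← Finset.sum_add_distrib]
  refine Finset.sum_congr rfl fun u _ => Finset.sum_congr rfl fun w _ => ?_
  by_cases h : G.Adj u w
  · rcases lt_or_gt_of_ne (hinj.ne h.ne) with h1 | h1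
    · simp [h, h1, h1.not_gt]
    · rw [← ha, neg_sub]; simp [h, h.symm, h1, h1.not_gt]
  · simp [h, mt SimpleGraph.Adj.symm h]

end Flux

end LpConsensus

/-! ### The sum of the weights, and the main energy estimate -/

namespace LpConsensus

section Contraction

variable {V : Type*} [Fintype V]

theorem rpow_half_sq {x : ℝ} (hx : 0 ≤ x) (s : ℝ) : (x ^ (s / 2)) ^ 2 = x ^ s := by
  rw [← Real.rpow_natCast, ← Real.rpow_mul hx]; congr 1; push_cast; ring

/-- Among the edges with increments bounded in a suitable way, those with a small rank difference
contribute little by monotonicity, the others by the bound on the flux through all cuts. -/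
theorem sum_rpow_sub_two_le {p : ℝ} (hp : 2 < p) (G : SimpleGraph V) (f : V → ℝ) {r : V → ℕ}
    (hinj : Function.Injective r)
    (hr : ∀ v, r v < Fintype.card V) (hrf : ∀ u v, r u ≤ r v → f u ≤ f v)
    (hT : 0 < totalFlux p G f) {Q : ℝ} (hQ0 : 0 ≤ Q) {S : Finset (V × V)}
    (hS : S ⊆ orderedEdges G r)
    (hpos : ∀ x ∈ S, 0 < f x.2 - f x.1) (hQ : ∀ x ∈ S, (f x.2 - f x.1) ^ ((p - 3) / 2) ≤ Q) :
    ∑ x ∈ S, (f x.2 - f x.1) ^ (p - 2) ≤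
      2 * Fintype.card V * √(totalFlux p G f) * Q := by
  classical
  set T := totalFlux p G f with hTdef
  set n : ℝ := (Fintype.card V : ℝ) with hn
  have hsT : 0 < √T := Real.sqrt_pos.mpr hT
  -- With R the rank difference and l the increment, the threshold R² l^(p-1) = T is where R
  -- l^((p-1)/2) equals √T: below it edges are counted, above it R l^(p-1) is large enough for the
  -- cut bound.
  let P : V × V → Prop := fun x =>
    ((r x.2 : ℝ) - r x.1) ^ 2 * (f x.2 - f x.1) ^ (p - 1) ≤ T
  have hRpos : ∀ x ∈ S, 0 < (r x.2 : ℝ) - r x.1 := fun x hx => by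
    have := (mem_orderedEdges.mp (hS hx)).2
    exact sub_pos.mpr (by exact_mod_cast this)
  have hsmall : ∑ x ∈ S with P x, (f x.2 - f x.1) ^ (p - 2) ≤ n * √T * Q := by
    rw [← Finset.sum_fiberwise (S.filter P) (fun x => x.1)]
    have h1 : ∀ u, ∑ x ∈ S.filter P with x.1 = u, (f x.2 - f x.1) ^ (p - 2) ≤ √T * Q := by
      intro u
      set F := (S.filter P).filter (fun x => x.1 = u) with hF
      rcases F.eq_empty_or_nonempty with h0 | h0
      · rw [h0, Finset.sum_empty]; positivity
      -- Among the edges with lower endpoint u, the one of highest upper rank has the largest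
      -- increment, and its rank difference bounds the number of edges. One edge thus controls the
      -- whole group.
      obtain ⟨z, hz, hmax⟩ := F.exists_max_image (fun x => r x.2) h0
      have hmem : ∀ x ∈ F, x ∈ S ∧ P x ∧ x.1 = u := fun x hx => by
        simp only [hF, Finset.mem_filter] at hx; exact ⟨hx.1.1, hx.1.2, hx.2⟩
      obtain ⟨hzS, hzP, hzu⟩ := hmem z hz
      set l := f z.2 - f z.1 with hl
      have hl0 : 0 < l := hpos z hzS
      have h2 : ∀ x ∈ F, (f x.2 - f x.1) ^ (p - 2) ≤ l ^ (p - 2) := by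
        intro x hx
        obtain ⟨hxS, -, hxu⟩ := hmem x hx
        refine Real.rpow_le_rpow (hpos x hxS).le ?_ (by linarith)
        have := hrf _ _ (hmax x hx)
        rw [hl, hxu, hzu]; linarith
      have h3 : F.card ≤ r z.2 - r z.1 := by
        rw [← Nat.card_Ioc]
        refine Finset.card_le_card_of_injOn (fun x => r x.2) (fun x hx => ?_) ?_
        · obtain ⟨hxS, -, hxu⟩ := hmem x hx
          have := (mem_orderedEdges.mp (hS hxS)).2
          rw [hxu, ← hzu] at this
          simpa using ⟨this, hmax x hx⟩
        · intro x hx y hy hxy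
          exact Prod.ext ((hmem x hx).2.2.trans (hmem y hy).2.2.symm) (hinj hxy)
      have hzr := (mem_orderedEdges.mp (hS hzS)).2
      have h3' : (F.card : ℝ) ≤ (r z.2 : ℝ) - r z.1 := by
        rw [← Nat.cast_sub hzr.le]; exact_mod_cast h3
      have h4 : ((r z.2 : ℝ) - r z.1) * l ^ ((p - 1) / 2) ≤ √T := by
        refine Real.le_sqrt_of_sq_le ?_
        rw [mul_pow, rpow_half_sq hl0.le]; exact hzP
      calc ∑ x ∈ F, (f x.2 - f x.1) ^ (p - 2) ≤ F.card • l ^ (p - 2) :=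
            Finset.sum_le_card_nsmul _ _ _ h2
        _ ≤ ((r z.2 : ℝ) - r z.1) * l ^ (p - 2) := by
            rw [nsmul_eq_mul]; exact mul_le_mul_of_nonneg_right h3' (by positivity)
        _ = (((r z.2 : ℝ) - r z.1) * l ^ ((p - 1) / 2)) * l ^ ((p - 3) / 2) := by
            rw [mul_assoc, ← Real.rpow_add hl0]; congr 2; ring
        _ ≤ √T * Q := mul_le_mul h4 (hQ z hzS) (by positivity) hsT.le
    refine (Finset.sum_le_sum fun u _ => h1 u).trans (le_of_eq ?_)
    rw [Finset.sum_const, Finset.card_univ, nsmul_eq_mul, mul_assoc]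
  have hlarge : ∑ x ∈ S with ¬P x, (f x.2 - f x.1) ^ (p - 2) ≤ n * √T * Q := by
    have h1 : ∀ x ∈ S.filter (fun x => ¬P x), (f x.2 - f x.1) ^ (p - 2) ≤
        (Q / √T) * (((r x.2 : ℝ) - r x.1) * |f x.2 - f x.1| ^ (p - 1)) := by
      intro x hx
      obtain ⟨hxS, hxP⟩ := Finset.mem_filter.mp hx
      have hl0 := hpos x hxS
      have hR := hRpos x hxS
      have hq := hQ x hxS
      rw [abs_of_pos hl0]
      set l := f x.2 - f x.1
      set R := (r x.2 : ℝ) - r x.1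
      -- The failed threshold trades a factor √T for R l^((p-1)/2), turning l^(p-2) into R l^(p-1)
      -- times l^((p-3)/2) ≤ Q.
      have h2 : √T ≤ R * l ^ ((p - 1) / 2) := by
        refine Real.sqrt_le_iff.mpr ⟨by positivity, ?_⟩
        rw [mul_pow, rpow_half_sq hl0.le]
        exact (not_le.mp hxP).le
      rw [div_mul_eq_mul_div, le_div_iff₀ hsT]
      calc l ^ (p - 2) * √T ≤ l ^ (p - 2) * (R * l ^ ((p - 1) / 2)) :=
            mul_le_mul_of_nonneg_left h2 (by positivity)
        _ = R * (l ^ (p - 2) * l ^ ((p - 1) / 2)) := by ring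
        _ = R * (l ^ ((p - 3) / 2) * l ^ (p - 1)) := by
            rw [← Real.rpow_add hl0, ← Real.rpow_add hl0]; congr 2; ring
        _ ≤ R * (Q * l ^ (p - 1)) := by gcongr
        _ = Q * (R * l ^ (p - 1)) := by ring
    refine (Finset.sum_le_sum h1).trans ?_
    rw [← Finset.mul_sum]
    have h2 : ∑ x ∈ S with ¬P x, ((r x.2 : ℝ) - r x.1) * |f x.2 - f x.1| ^ (p - 1) ≤ n * T := by
      refine le_trans (Finset.sum_le_sum_of_subset_of_nonneg
        ((Finset.filter_subset _ _).trans hS) fun x hx _ => ?_)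
        (sum_rank_mul_le (by linarith) G f hr hrf)
      have := (mem_orderedEdges.mp hx).2
      exact mul_nonneg (sub_nonneg.mpr (by exact_mod_cast this.le)) (by positivity)
    refine (mul_le_mul_of_nonneg_left h2 (by positivity)).trans (le_of_eq ?_)
    have h3 : T = √T * √T := (Real.mul_self_sqrt hT.le).symm
    rw [div_mul_eq_mul_div, div_eq_iff hsT.ne']
    nth_rewrite 1 [h3]
    ring
  rw [← Finset.sum_filter_add_sum_filter_not S P]
  linarith

theorem totalFlux_rpow_inv_rpow {p : ℝ} (hp : 1 < p) (G : SimpleGraph V) (f : V → ℝ) :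
    (totalFlux p G f ^ (p - 1)⁻¹) ^ (p - 1) = totalFlux p G f :=
  Real.rpow_inv_rpow (totalFlux_nonneg p G f) (by linarith)

theorem edge_le {p : ℝ} (hp : 1 < p) (G : SimpleGraph V) (f : V → ℝ) {u w : V}
    (h : G.Adj u w) : |f w - f u| ≤ totalFlux p G f ^ (p - 1)⁻¹ := by
  have h1 := Real.rpow_le_rpow (by positivity) (edge_flux_le hp G f h)
    (show 0 ≤ (p - 1)⁻¹ from inv_nonneg.mpr (by linarith))
  rwa [Real.rpow_rpow_inv (abs_nonneg _) (by linarith)] at h1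

/-- Here l^((p-3)/2) is increasing in l, so the universal edge bound l ≤ L supplies Q. -/
theorem sum_weightSum_le_of_three_le {p : ℝ} (hp : 3 ≤ p) (G : SimpleGraph V) (f : V → ℝ)
    (hT : 0 < totalFlux p G f) :
    ∑ v, weightSum (fun x => |x| ^ (p - 2)) G f v ≤
      4 * Fintype.card V * (totalFlux p G f ^ (p - 1)⁻¹) ^ (p - 2) := by
  classical
  have hp1 : 1 < p := by linarith
  obtain ⟨r, hinj, hr, hrf⟩ := exists_rank f
  rw [sum_weightSum_eq G f hinj _ fun x => by simp]
  set L := totalFlux p G f ^ (p - 1)⁻¹ with hL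
  have hL0 : 0 < L := Real.rpow_pos_of_pos hT _
  have hLT : L ^ (p - 1) = totalFlux p G f := totalFlux_rpow_inv_rpow hp1 G f
  have hsT : √(totalFlux p G f) = L ^ ((p - 1) / 2) := by
    rw [← hLT, ← rpow_half_sq hL0.le, Real.sqrt_sq (by positivity)]
  set S := (orderedEdges G r).filter fun x => 0 < f x.2 - f x.1 with hS
  have hedge : ∀ x ∈ orderedEdges G r, 0 ≤ f x.2 - f x.1 := fun x hx =>
    sub_nonneg.mpr (hrf _ _ (mem_orderedEdges.mp hx).2.le)
  have h1 : ∑ x ∈ orderedEdges G r, |f x.2 - f x.1| ^ (p - 2) =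
      ∑ x ∈ S, (f x.2 - f x.1) ^ (p - 2) := by
    rw [hS, Finset.sum_filter]
    refine Finset.sum_congr rfl fun x hx => ?_
    rcases (hedge x hx).eq_or_lt with h | h
    · rw [← h]; simp [Real.zero_rpow (show p - 2 ≠ 0 by linarith)]
    · rw [if_pos h, abs_of_pos h]
  have h2 := sum_rpow_sub_two_le (by linarith) G f hinj hr hrf hT
    (Q := L ^ ((p - 3) / 2)) (by positivity) (S := S) (Finset.filter_subset _ _)
    (fun x hx => (Finset.mem_filter.mp hx).2) (fun x hx => by
      obtain ⟨hx1, hx2⟩ := Finset.mem_filter.mp hx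
      have := edge_le hp1 G f (mem_orderedEdges.mp hx1).1
      rw [abs_of_pos hx2] at this
      exact Real.rpow_le_rpow hx2.le this (by linarith))
  have h3 : √(totalFlux p G f) * L ^ ((p - 3) / 2) = L ^ (p - 2) := by
    rw [hsT, ← Real.rpow_add hL0]; congr 1; ring
  rw [mul_assoc, h3] at h2
  rw [h1]
  linarith

/-- Now l^((p-3)/2) blows up as the increment tends to 0, so increments are truncated at l. The at
most n² shorter edges contribute at most n² l^(p-2), and the relation n² l^(p-1) = T makes the
longer ones contribute a multiple of the same quantity. -/
theorem sum_weightSum_le_of_le_three {p : ℝ} (hp2 : 2 < p) (hp : p ≤ 3) (G : SimpleGraph V)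
    (f : V → ℝ) (hT : 0 < totalFlux p G f) {l : ℝ} (hl : 0 < l)
    (hlT : (Fintype.card V : ℝ) ^ 2 * l ^ (p - 1) = totalFlux p G f) :
    ∑ v, weightSum (fun x => |x| ^ (p - 2)) G f v ≤
      6 * (Fintype.card V : ℝ) ^ 2 * l ^ (p - 2) := by
  classical
  obtain ⟨r, hinj, hr, hrf⟩ := exists_rank f
  rw [sum_weightSum_eq G f hinj _ fun x => by simp]
  set n : ℝ := (Fintype.card V : ℝ) with hn
  have hn0 : 0 ≤ n := by positivity
  have hsT : √(totalFlux p G f) = n * l ^ ((p - 1) / 2) := by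
    rw [← hlT, ← rpow_half_sq hl.le, ← mul_pow, Real.sqrt_sq (by positivity)]
  have hedge : ∀ x ∈ orderedEdges G r, 0 ≤ f x.2 - f x.1 := fun x hx =>
    sub_nonneg.mpr (hrf _ _ (mem_orderedEdges.mp hx).2.le)
  set S := (orderedEdges G r).filter fun x => l < f x.2 - f x.1 with hS
  have hmem : ∀ x ∈ S, 0 < f x.2 - f x.1 := fun x hx =>
    hl.trans (Finset.mem_filter.mp hx).2
  have h2 := sum_rpow_sub_two_le hp2 G f hinj hr hrf hT
    (Q := l ^ ((p - 3) / 2)) (by positivity) (S := S) (Finset.filter_subset _ _) hmem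
    (fun x hx => Real.rpow_le_rpow_of_nonpos hl (Finset.mem_filter.mp hx).2.le (by linarith))
  have h3 : √(totalFlux p G f) * l ^ ((p - 3) / 2) = n * l ^ (p - 2) := by
    rw [hsT, mul_assoc, ← Real.rpow_add hl]; congr 2; ring
  rw [mul_assoc, h3] at h2
  have h4 : ∑ x ∈ orderedEdges G r with ¬ l < f x.2 - f x.1, |f x.2 - f x.1| ^ (p - 2) ≤
      n ^ 2 * l ^ (p - 2) := by
    refine (Finset.sum_le_card_nsmul _ _ (l ^ (p - 2)) fun x hx => ?_).trans ?_
    · obtain ⟨hx1, hx2⟩ := Finset.mem_filter.mp hx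
      rw [abs_of_nonneg (hedge x hx1)]
      exact Real.rpow_le_rpow (hedge x hx1) (not_lt.mp hx2) (by linarith)
    · rw [nsmul_eq_mul]
      refine mul_le_mul_of_nonneg_right ?_ (by positivity)
      have := Finset.card_le_univ ((orderedEdges G r).filter fun x => ¬ l < f x.2 - f x.1)
      rw [Fintype.card_prod] at this
      rw [hn, sq]; exact_mod_cast this
  have h5 : ∑ x ∈ S, |f x.2 - f x.1| ^ (p - 2) = ∑ x ∈ S, (f x.2 - f x.1) ^ (p - 2) :=
    Finset.sum_congr rfl fun x hx => by rw [abs_of_pos (hmem x hx)]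
  rw [← Finset.sum_filter_add_sum_filter_not _ (fun x : V × V => l < f x.2 - f x.1), ← hS, h5]
  nlinarith

theorem exists_expansionBound_of_two_le {p : ℝ} (hp : 2 ≤ p) :
    ∃ K, 0 < K ∧ ExpansionBound p K fun x => |x| ^ (p - 2) :=
  ⟨p ^ 2 * 2 ^ (p - 2), by positivity, abs_sub_rpow_le_of_two_le hp⟩

theorem exists_expansionBound_of_le_two {p : ℝ} (hp : 1 < p) (hp2 : p ≤ 2) :
    ∃ K, 0 < K ∧ ExpansionBound p K fun _ => 0 :=
  ⟨2 * p, by positivity, fun x h => by simpa using abs_sub_rpow_le_of_le_two hp hp2 x h⟩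

theorem energy_le_card_mul {p : ℝ} (hp : 1 < p) {G : SimpleGraph V} (hG : G.Connected)
    (f : V → ℝ) : energy p G f ≤
      Fintype.card V * totalFlux p G f ^ (p - 1)⁻¹ * totalFlux p G f := by
  obtain ⟨u⟩ := hG.nonempty
  exact energy_le_mul_totalFlux hp G (abs_sub_le_of_edge_bound hG
    (Real.rpow_nonneg (totalFlux_nonneg p G f) _) fun u w h => edge_le hp G f h) u

/-- Since T^(p/(p-1)) = LT, the hypothesis bounds LT, and E ≤ nLT adds one factor n: 1 + 2/(p-1) =
2p/(p-1) - 1. -/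
theorem energy_le_of_first {p : ℝ} (hp : 1 < p) {G : SimpleGraph V} (hG : G.Connected)
    (f : V → ℝ) {B Δ : ℝ}
    (h : (totalFlux p G f / 2) ^ (p / (p - 1)) ≤
      B * (Fintype.card V : ℝ) ^ (2 / (p - 1)) * Δ) :
    energy p G f ≤ (2 ^ (p / (p - 1)) * B) * (Fintype.card V : ℝ) ^ (2 * p / (p - 1) - 1) * Δ := by
  have hE := energy_le_card_mul hp hG f
  set T := totalFlux p G f with hT
  have hT0 : 0 ≤ T := totalFlux_nonneg p G f
  have := hG.nonempty
  have hn : 0 < (Fintype.card V : ℝ) := Nat.cast_pos.mpr Fintype.card_pos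
  set n : ℝ := (Fintype.card V : ℝ)
  have hp1 : 0 < p - 1 := by linarith
  have h1 : T ^ (p / (p - 1)) = T ^ (p - 1)⁻¹ * T := by
    rw [← Real.rpow_add_one' hT0 (by positivity)]; congr 1; field_simp; ring
  rw [Real.div_rpow hT0 (by norm_num), div_le_iff₀ (by positivity), h1] at h
  have h2 : n ^ (2 * p / (p - 1) - 1) = n * n ^ (2 / (p - 1)) := by
    rw [mul_comm n, ← Real.rpow_add_one hn.ne']; congr 1; field_simp; ring
  rw [h2]
  calc energy p G f ≤ n * (T ^ (p - 1)⁻¹ * T) := by linarith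
    _ ≤ n * (B * n ^ (2 / (p - 1)) * Δ * 2 ^ (p / (p - 1))) :=
      mul_le_mul_of_nonneg_left h hn.le
    _ = _ := by ring

/-- The main estimate: the sum of the energy decrements over all possible updates. -/
theorem exists_energy_le_sum_drop {p : ℝ} (hp : 1 < p) : ∃ C : ℝ, 0 < C ∧
    ∀ (V : Type*) [Fintype V] (G : SimpleGraph V), G.Connected → ∀ f : V → ℝ,
      energy p G f ≤ C * (Fintype.card V : ℝ) ^ (beta p - 1) *
        ∑ v, (energy p G f - energy p G (step p G f v)) := by
  have mono : ∀ {n B C Δ e : ℝ}, 1 ≤ n → 0 ≤ Δ → 0 ≤ B → B ≤ C → e ≤ beta p - 1 →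
      B * n ^ e * Δ ≤ C * n ^ (beta p - 1) * Δ := by
    intro n B C Δ e hn hΔ hB hBC he
    refine mul_le_mul_of_nonneg_right (mul_le_mul hBC
      (Real.rpow_le_rpow_of_exponent_le hn he) (by positivity) (hB.trans hBC)) hΔ
  have hb1 : 2 * p / (p - 1) - 1 ≤ beta p - 1 := by
    have := le_max_left (2 * p / (p - 1)) 3
    unfold beta; linarith
  have hb2 : 2 ≤ beta p - 1 := by
    have := le_max_right (2 * p / (p - 1)) 3
    unfold beta; linarith
  have hp1 : 0 < p - 1 := by linarith
  rcases le_or_gt p 2 with hp2 | hp2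
  · obtain ⟨K, hK, H⟩ := exists_expansionBound_of_le_two hp hp2
    refine ⟨2 ^ (p / (p - 1)) * (2 * (4 * K) ^ (p - 1)⁻¹), by positivity, fun V _ G hG f => ?_⟩
    have := hG.nonempty
    have hn1 : (1 : ℝ) ≤ Fintype.card V := Nat.one_le_cast.mpr Fintype.card_pos
    have hΔ : 0 ≤ ∑ v, (energy p G f - energy p G (step p G f v)) :=
      Finset.sum_nonneg fun v _ => sub_nonneg.mpr (energy_step_le hp G f v)
    refine (energy_le_of_first hp hG f ?_).trans (mono hn1 hΔ (by positivity) le_rfl hb1)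
    rcases total_flux_le_of_drop hp hK (fun _ => le_rfl) H G f with h | h
    · exact h
    -- With zero weights the second alternative says that T = 0, and then the first one holds
    -- trivially.
    · have h0 : ∑ v, weightSum (fun _ => (0 : ℝ)) G f v = 0 := by simp [weightSum]
      rw [h0, mul_zero] at h
      have h1 : (∑ v, |flux p G f v (f v)|) / 2 = 0 := pow_eq_zero_iff two_ne_zero |>.mp
        (le_antisymm h (sq_nonneg _))
      unfold totalFlux
      rw [h1, Real.zero_rpow (by positivity)]
      positivity
  · obtain ⟨K, hK, H⟩ := exists_expansionBound_of_two_le hp2.le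
    refine ⟨2 ^ (p / (p - 1)) * (2 * (4 * K) ^ (p - 1)⁻¹) + 192 * K, by positivity,
      fun V _ G hG f => ?_⟩
    have := hG.nonempty
    have hn1 : (1 : ℝ) ≤ Fintype.card V := Nat.one_le_cast.mpr Fintype.card_pos
    have hΔ : 0 ≤ ∑ v, (energy p G f - energy p G (step p G f v)) :=
      Finset.sum_nonneg fun v _ => sub_nonneg.mpr (energy_step_le hp G f v)
    have hE := energy_le_card_mul hp hG f
    rcases (totalFlux_nonneg p G f).eq_or_lt with hT | hT
    · rw [← hT, mul_zero] at hE
      exact hE.trans (by positivity)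
    rcases total_flux_le_of_drop hp hK (fun x => by positivity) H G f with h | h
    · exact (energy_le_of_first hp hG f h).trans
        (mono hn1 hΔ (by positivity) (by linarith) hb1)
    · change (totalFlux p G f / 2) ^ 2 ≤ _ at h
      set Δ := ∑ v, (energy p G f - energy p G (step p G f v)) with hΔdef
      set n : ℝ := (Fintype.card V : ℝ) with hn
      have hn0 : 0 < n := by linarith
      set L := totalFlux p G f ^ (p - 1)⁻¹ with hL
      have hL0 : 0 < L := Real.rpow_pos_of_pos hT _
      have hLT : L ^ (p - 1) = totalFlux p G f := totalFlux_rpow_inv_rpow hp G f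
      have hsplit : ∀ l : ℝ, 0 < l → l ^ (p - 1) = l ^ (p - 2) * l := by
        intro l hl
        rw [← Real.rpow_add_one hl.ne']; congr 1; ring
      rcases le_or_gt 3 p with hp3 | hp3
      · have hA := sum_weightSum_le_of_three_le hp3 G f hT
        have h1 := h.trans (mul_le_mul_of_nonneg_left hA (by positivity))
        rw [← hL, ← hn] at h1
        -- T² = L^(p-2) · LT, so the weight bound cancels against one factor and leaves LT ≤ 128 K n
        -- Δ.
        have h2 : L ^ (p - 2) * (L * totalFlux p G f) ≤ L ^ (p - 2) * (128 * K * n * Δ) := by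
          rw [← mul_assoc, ← hsplit L hL0, hLT]
          linarith
        have h3 := le_of_mul_le_mul_left h2 (by positivity)
        refine le_trans ?_ (mono (e := 2) (B := 192 * K) hn1 hΔ (by positivity)
          (le_add_of_nonneg_left (by positivity)) hb2)
        calc energy p G f ≤ n * (L * totalFlux p G f) := by linarith
          _ ≤ n * (128 * K * n * Δ) := mul_le_mul_of_nonneg_left h3 hn0.le
          _ = 128 * K * n ^ 2 * Δ := by ring
          _ ≤ 192 * K * n ^ 2 * Δ := by gcongr; norm_num
          _ = 192 * K * n ^ (2 : ℝ) * Δ := by rw [Real.rpow_two]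
      -- The truncation level solves n² l^(p-1) = T. Then T² = n² l^(p-2) · lT, and passing from l
      -- back to L costs exactly n^(2/(p-1)).
      · set l := L * n ^ (-(2 / (p - 1))) with hl
        have hl0 : 0 < l := by positivity
        have hlT : n ^ 2 * l ^ (p - 1) = totalFlux p G f := by
          rw [hl, Real.mul_rpow hL0.le (by positivity), hLT, ← Real.rpow_mul hn0.le,
            show -(2 / (p - 1)) * (p - 1) = -2 by field_simp, Real.rpow_neg hn0.le, Real.rpow_two]
          field_simp
        have hA := sum_weightSum_le_of_le_three hp2 hp3.le G f hT hl0 hlT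
        have h1 := h.trans (mul_le_mul_of_nonneg_left hA (by positivity))
        rw [← hn] at h1
        have h2 : (n ^ 2 * l ^ (p - 2)) * (l * totalFlux p G f) ≤
            (n ^ 2 * l ^ (p - 2)) * (192 * K * Δ) := by
          have : (n ^ 2 * l ^ (p - 2)) * (l * totalFlux p G f) =
            totalFlux p G f * totalFlux p G f := by
              nth_rewrite 2 [← hlT]; rw [hsplit l hl0]; ring
          rw [this]
          linarith
        have h3 := le_of_mul_le_mul_left h2 (by positivity)
        have hLl : L = l * n ^ (2 / (p - 1)) := by
          rw [hl, mul_assoc, ← Real.rpow_add hn0]; simp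
        have hpow : n ^ (2 * p / (p - 1) - 1) = n * n ^ (2 / (p - 1)) := by
          rw [mul_comm n, ← Real.rpow_add_one hn0.ne']; congr 1; field_simp; ring
        refine le_trans ?_ (mono (B := 192 * K) hn1 hΔ (by positivity)
          (le_add_of_nonneg_left (by positivity)) hb1)
        rw [hpow]
        calc energy p G f ≤ n * n ^ (2 / (p - 1)) * (l * totalFlux p G f) := by
              rw [hLl] at hE; linarith
          _ ≤ n * n ^ (2 / (p - 1)) * (192 * K * Δ) :=
              mul_le_mul_of_nonneg_left h3 (by positivity)
          _ = _ := by ring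

end Contraction

end LpConsensus

/-! ### Random updates: exponential decay and expected consensus time -/

namespace LpConsensus

section Random

theorem osc_le_of_forall {V : Type*} [Nonempty V] {f : V → ℝ} {B : ℝ} (h : ∀ u v, f v - f u ≤ B) :
    osc f ≤ B := by
  have h1 : ⨆ v, f v ≤ B + ⨅ v, f v := by
    refine ciSup_le fun v => ?_
    have : f v - B ≤ ⨅ u, f u := le_ciInf fun u => by linarith [h u v]
    linarith
  unfold osc; linarith

theorem tsum_le_of_exp_bound {κ W : ℝ} (hκ : 0 < κ) (hW : 1 ≤ W) {m : ℕ → ℝ≥0∞}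
    (h1 : ∀ t, m t ≤ 1) (h2 : ∀ t : ℕ, m t ≤ ENNReal.ofReal (Real.exp (-(κ * t)) * W)) :
    ∑' t, m t ≤ ENNReal.ofReal (Real.log W / κ + 2 + 1 / κ) := by
  -- The bound 1 is used up to the time at which W e^(-κt) falls below 1, and a geometric series
  -- afterwards.
  set t₀ := ⌈Real.log W / κ⌉₊ with ht₀
  have hlog : 0 ≤ Real.log W / κ := div_nonneg (Real.log_nonneg hW) hκ.le
  have hW0 : 0 < W := by linarith
  have h3 : ∀ s : ℕ, m (s + t₀) ≤ ENNReal.ofReal (Real.exp (-κ) ^ s) := by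
    intro s
    refine (h2 _).trans (ENNReal.ofReal_le_ofReal ?_)
    rw [← Real.exp_nat_mul]
    nth_rewrite 1 [← Real.exp_log hW0]
    rw [← Real.exp_add]
    refine Real.exp_le_exp.mpr ?_
    have := Nat.le_ceil (Real.log W / κ)
    rw [← ht₀, div_le_iff₀ hκ] at this
    push_cast
    linarith
  have hr1 : Real.exp (-κ) < 1 := Real.exp_lt_one_iff.mpr (by linarith)
  have h4 : ∑' s, m (s + t₀) ≤ ENNReal.ofReal (1 + 1 / κ) := by
    refine (ENNReal.tsum_le_tsum h3).trans ?_
    rw [← ENNReal.ofReal_tsum_of_nonneg (fun s => by positivity)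
      (summable_geometric_of_lt_one (Real.exp_pos _).le hr1),
      tsum_geometric_of_lt_one (Real.exp_pos _).le hr1]
    refine ENNReal.ofReal_le_ofReal ?_
    have h5 := Real.add_one_le_exp κ
    rw [inv_le_comm₀ (by linarith) (by positivity), Real.exp_neg]
    have h6 : (Real.exp κ)⁻¹ ≤ (κ + 1)⁻¹ := inv_anti₀ (by positivity) h5
    have h7 : (1 + 1 / κ)⁻¹ = 1 - (κ + 1)⁻¹ := by field_simp; ring
    linarith
  rw [← Summable.sum_add_tsum_nat_add' (f := m) (k := t₀) ENNReal.summable]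
  have h5 : ∑ t ∈ Finset.range t₀, m t ≤ ENNReal.ofReal t₀ := by
    refine (Finset.sum_le_card_nsmul _ _ 1 fun t _ => h1 t).trans (le_of_eq ?_)
    simp
  refine (add_le_add h5 h4).trans ?_
  rw [← ENNReal.ofReal_add (by positivity) (by positivity)]
  refine ENNReal.ofReal_le_ofReal ?_
  have := Nat.ceil_lt_add_one hlog
  rw [← ht₀] at this
  linarith

variable {V : Type*} [Fintype V]

theorem profile_congr (p : ℝ) (G : SimpleGraph V) (f₀ : V → ℝ) {v w : ℕ → V} {t : ℕ}
    (h : ∀ s < t, v s = w s) : profile p G f₀ v t = profile p G f₀ w t := by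
  induction t with
  | zero => rfl
  | succ t ih =>
    simp only [profile]
    rw [ih fun s hs => h s (hs.trans t.lt_succ_self), h t t.lt_succ_self]

theorem edge_rpow_le_energy {p : ℝ} (G : SimpleGraph V) (f : V → ℝ) {u w : V} (h : G.Adj u w) :
    |f w - f u| ^ p ≤ energy p G f := by
  classical
  unfold energy
  have := Finset.single_le_sum (s := G.edgeFinset) (f := fun e => Sym2.lift
    ⟨fun u v => |f u - f v| ^ p, fun u v => by simp only [abs_sub_comm]⟩ e)
    (fun e _ => by
      induction e with | _ a b => exact Real.rpow_nonneg (abs_nonneg _) _)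
    (show s(w, u) ∈ G.edgeFinset by simpa using h.symm)
  exact this

theorem sub_le_osc (f : V → ℝ) (u v : V) : f v - f u ≤ osc f :=
  sub_le_sub (le_ciSup (Set.finite_range f).bddAbove v) (ciInf_le (Set.finite_range f).bddBelow u)

/-- Each increment is at most E^(1/p), and a path joining two vertices has fewer than n edges. -/
theorem rpow_le_energy_of_lt_osc {p : ℝ} (hp : 1 < p) {G : SimpleGraph V} (hG : G.Connected)
    {f : V → ℝ} {ε : ℝ} (hε : 0 < ε) (h : ε < osc f) :
    (ε / Fintype.card V) ^ p ≤ energy p G f := by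
  have := hG.nonempty
  have hn0 : 0 < (Fintype.card V : ℝ) := Nat.cast_pos.mpr Fintype.card_pos
  have hE := energy_nonneg p G f
  have h1 := abs_sub_le_of_edge_bound hG (f := f) (L := energy p G f ^ p⁻¹)
    (Real.rpow_nonneg hE _) fun u w huw => by
      have h2 := Real.rpow_le_rpow (by positivity) (edge_rpow_le_energy (p := p) G f huw)
        (show 0 ≤ p⁻¹ by positivity)
      rwa [Real.rpow_rpow_inv (abs_nonneg _) (by linarith)] at h2
  have h2 := h.trans_le (osc_le_of_forall fun u v => (le_abs_self _).trans (h1 u v))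
  have h3 : ε / Fintype.card V ≤ energy p G f ^ p⁻¹ := by
    rw [div_le_iff₀ hn0]; linarith
  have h4 := Real.rpow_le_rpow (by positivity) h3 (show 0 ≤ p by linarith)
  rwa [Real.rpow_inv_rpow hE (by linarith)] at h4

theorem energy_le_sq {p : ℝ} (hp : 1 < p) (G : SimpleGraph V) {f : V → ℝ}
    (hf : ∀ x, f x ∈ Set.Icc (0 : ℝ) 1) : energy p G f ≤ (Fintype.card V : ℝ) ^ 2 := by
  classical
  have h1 := two_mul_energy p G f
  have h2 : ∀ v, localSum p G f v (f v) ≤ Fintype.card V := by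
    intro v
    unfold localSum
    refine (Finset.sum_le_card_nsmul _ _ 1 fun w _ => ?_).trans ?_
    · refine Real.rpow_le_one (abs_nonneg _) ?_ (by linarith)
      have := hf w; have := hf v
      simp only [Set.mem_Icc] at *
      rw [abs_le]; constructor <;> linarith
    · rw [nsmul_eq_mul, mul_one]; exact_mod_cast Finset.card_le_univ _
  have h3 : ∑ v, localSum p G f v (f v) ≤ (Fintype.card V : ℝ) ^ 2 := by
    refine (Finset.sum_le_sum fun v _ => h2 v).trans (le_of_eq ?_)
    rw [Finset.sum_const, Finset.card_univ, nsmul_eq_mul, sq]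
  linarith [energy_nonneg p G f]

theorem natCast_le_consensusTime {p : ℝ} {G : SimpleGraph V} {f₀ : V → ℝ} {v : ℕ → V} {ε : ℝ}
    {k : ℕ∞} (h : ∀ t : ℕ, osc (profile p G f₀ v t) ≤ ε → k ≤ t) :
    k ≤ consensusTime p G f₀ v ε :=
  le_iInf₂ h

/-- Every time before τ has oscillation above ε, so τ is at most the number of such times. This
inequality needs no monotonicity of the oscillation. -/
theorem consensusTime_le_tsum (p : ℝ) (G : SimpleGraph V) (f₀ : V → ℝ) (v : ℕ → V) (ε : ℝ) :
    (consensusTime p G f₀ v ε : ℝ≥0∞) ≤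
      ∑' t : ℕ, if ε < osc (profile p G f₀ v t) then (1 : ℝ≥0∞) else 0 := by
  have hlt : ∀ t : ℕ, (t : ℕ∞) < consensusTime p G f₀ v ε → ε < osc (profile p G f₀ v t) := by
    intro t ht
    by_contra! h
    exact (not_le.mpr ht) (iInf₂_le t h)
  have key : ∀ k : ℕ, (k : ℕ∞) ≤ consensusTime p G f₀ v ε →
      (k : ℝ≥0∞) ≤ ∑' t : ℕ, if ε < osc (profile p G f₀ v t) then (1 : ℝ≥0∞) else 0 := by
    intro k hk
    refine le_trans (le_of_eq ?_) (ENNReal.sum_le_tsum (Finset.range k))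
    rw [Finset.sum_congr rfl fun t ht => if_pos (hlt t (lt_of_lt_of_le
      (by exact_mod_cast Finset.mem_range.mp ht) hk))]
    simp
  cases h : consensusTime p G f₀ v ε with
  | top =>
    rw [h] at key
    refine le_of_le_of_eq le_top (ENNReal.eq_top_of_forall_nnreal_le fun r => ?_).symm
    obtain ⟨k, hk⟩ := exists_nat_ge r
    exact le_trans (by exact_mod_cast hk) (key k le_top)
  | coe k =>
    simpa using key k h.ge

/-- Any function of the profile at time `t` is a function of the first `t` updates. -/
theorem exists_profile_eq_comp {β Ω : Type*} [Nonempty V] (p : ℝ) (G : SimpleGraph V) (f₀ : V → ℝ)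
    (t : ℕ) (H : (V → ℝ) → β) : ∃ h : (Finset.range t → V) → β, ∀ v : ℕ → Ω → V,
      (fun ω => H (profile p G f₀ (fun s => v s ω) t)) = h ∘ fun ω i => v i ω := by
  classical
  refine ⟨fun x => H (profile p G f₀
    (fun s => if hs : s ∈ Finset.range t then x ⟨s, hs⟩ else Classical.arbitrary V) t),
    fun v => funext fun ω => ?_⟩
  simp only [Function.comp]
  congr 1
  refine profile_congr p G f₀ fun s hs => ?_
  rw [dif_pos (Finset.mem_range.mpr hs)]

section Measure

variable [MeasurableSpace V] [DiscreteMeasurableSpace V] {Ω : Type*} [MeasurableSpace Ω]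
  {P : Measure Ω} {v : ℕ → Ω → V}

theorem measurable_profile_comp {β : Type*} [MeasurableSpace β] [Nonempty V] (p : ℝ)
    (G : SimpleGraph V) (f₀ : V → ℝ) (hv : ∀ t, Measurable (v t)) (t : ℕ) (H : (V → ℝ) → β) :
    Measurable fun ω => H (profile p G f₀ (fun s => v s ω) t) := by
  obtain ⟨h, hh⟩ := exists_profile_eq_comp (Ω := Ω) p G f₀ t H
  rw [hh v]
  exact (Measurable.of_discrete).comp (measurable_pi_lambda _ fun i => hv i)

theorem integrable_profile_comp [IsFiniteMeasure P] [Nonempty V] (p : ℝ)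
    (G : SimpleGraph V) (f₀ : V → ℝ) (hv : ∀ t, Measurable (v t)) (t : ℕ) (H : (V → ℝ) → ℝ) :
    Integrable (fun ω => H (profile p G f₀ (fun s => v s ω) t)) P := by
  obtain ⟨h, hh⟩ := exists_profile_eq_comp (Ω := Ω) p G f₀ t H
  rw [hh v]
  exact Integrable.comp_measurable Integrable.of_finite (measurable_pi_lambda _ fun i => hv i)

theorem measureReal_update_eq [IsProbabilityMeasure P]
    (hU : IsUniformUpdates P v) (t : ℕ) (u : V) :
    P.real (v t ⁻¹' {u}) = (Fintype.card V : ℝ)⁻¹ := by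
  rw [measureReal_def, ← Measure.map_apply (hU.measurable t) (measurableSet_singleton u),
    hU.uniform t, uniformOn_univ, Measure.count_singleton, ENNReal.toReal_div]
  simp

/-- The vertex v t is uniform and independent of the first t updates, which determine the profile.
Splitting over the finitely many values of v t and factoring each expectation replaces conditioning.
-/
theorem integral_profile_succ [IsProbabilityMeasure P] [Nonempty V] (p : ℝ)
    (G : SimpleGraph V) (f₀ : V → ℝ) (hU : IsUniformUpdates P v) (t : ℕ) (H : (V → ℝ) → ℝ) :
    ∫ ω, H (profile p G f₀ (fun s => v s ω) (t + 1)) ∂P =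
      ∫ ω, (Fintype.card V : ℝ)⁻¹ * ∑ u, H (step p G (profile p G f₀ (fun s => v s ω) t) u) ∂P := by
  classical
  have hsplit : ∀ ω, H (profile p G f₀ (fun s => v s ω) (t + 1)) =
      ∑ u, (v t ⁻¹' {u}).indicator (fun _ => (1 : ℝ)) ω *
        H (step p G (profile p G f₀ (fun s => v s ω) t) u) := by
    intro ω
    rw [Finset.sum_eq_single (v t ω)]
    · simp [profile]
    · intro u _ hu
      rw [Set.indicator_of_notMem (by simpa using hu.symm), zero_mul]
    · simp
  have hind : ∀ u, Measurable ((v t ⁻¹' {u}).indicator fun _ => (1 : ℝ)) := fun u =>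
    measurable_const.indicator (hU.measurable t (measurableSet_singleton u))
  have hterm : ∀ u, ∫ ω, (v t ⁻¹' {u}).indicator (fun _ => (1 : ℝ)) ω *
        H (step p G (profile p G f₀ (fun s => v s ω) t) u) ∂P =
      (Fintype.card V : ℝ)⁻¹ * ∫ ω, H (step p G (profile p G f₀ (fun s => v s ω) t) u) ∂P := by
    intro u
    obtain ⟨h, hh⟩ := exists_profile_eq_comp (Ω := Ω) p G f₀ t fun g => H (step p G g u)
    have hindep := hU.indep.indepFun_finset {t} (Finset.range t) (by simp) hU.measurable
    have hindep' := hindep.comp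
      (φ := fun x : (({t} : Finset ℕ) → V) =>
        if x ⟨t, Finset.mem_singleton_self t⟩ = u then (1 : ℝ) else 0)
      (ψ := h) Measurable.of_discrete Measurable.of_discrete
    have h1 := hindep'.integral_mul_eq_mul_integral
      (Measurable.aestronglyMeasurable
        ((Measurable.of_discrete).comp (measurable_pi_lambda _ fun i => hU.measurable i)))
      (Measurable.aestronglyMeasurable
        ((Measurable.of_discrete).comp (measurable_pi_lambda _ fun i => hU.measurable i)))
    rw [← hh v] at h1
    have h2 : ((fun x : (({t} : Finset ℕ) → V) =>
        if x ⟨t, Finset.mem_singleton_self t⟩ = u then (1 : ℝ) else 0) ∘ fun ω i => v i ω) =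
        (v t ⁻¹' {u}).indicator fun _ => (1 : ℝ) := by
      ext ω
      by_cases hω : v t ω = u <;> simp [Set.indicator, hω]
    rw [h2, integral_indicator_const _ (hU.measurable t (measurableSet_singleton u)),
      measureReal_update_eq hU] at h1
    simpa using h1
  have hint : ∀ u, Integrable (fun ω => H (step p G (profile p G f₀ (fun s => v s ω) t) u)) P :=
    fun u => integrable_profile_comp p G f₀ hU.measurable t fun g => H (step p G g u)
  simp only [hsplit]
  rw [integral_finsetSum, integral_const_mul, integral_finsetSum _ fun u _ => hint u,
    Finset.mul_sum]
  · exact Finset.sum_congr rfl fun u _ => hterm u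
  · intro u _
    refine (hint u).bdd_mul (c := 1) (hind u).aestronglyMeasurable (ae_of_all _ fun ω => ?_)
    by_cases hω : ω ∈ v t ⁻¹' {u} <;> simp [Set.indicator, hω]

theorem integral_energy_le [IsProbabilityMeasure P] {p C : ℝ} (hC : 0 < C)
    [Nonempty V] {G : SimpleGraph V}
    (hE : ∀ f : V → ℝ, energy p G f ≤ C * (Fintype.card V : ℝ) ^ (beta p - 1) *
        ∑ v, (energy p G f - energy p G (step p G f v)))
    (f₀ : V → ℝ) (hU : IsUniformUpdates P v) (t : ℕ) :
    ∫ ω, energy p G (profile p G f₀ (fun s => v s ω) t) ∂P ≤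
      Real.exp (-(C⁻¹ * (Fintype.card V : ℝ) ^ (-beta p) * t)) * energy p G f₀ := by
  set n : ℝ := (Fintype.card V : ℝ) with hn
  have hn0 : 0 < n := Nat.cast_pos.mpr Fintype.card_pos
  have hstep : ∀ f : V → ℝ, n⁻¹ * ∑ u, energy p G (step p G f u) ≤
      Real.exp (-(C⁻¹ * n ^ (-beta p))) * energy p G f := by
    intro f
    have h1 := hE f
    have h2 : n ^ (beta p - 1) * n ^ (-beta p) = n⁻¹ := by
      rw [← Real.rpow_add hn0, ← Real.rpow_neg_one]; congr 1; ring
    rw [Finset.sum_sub_distrib, Finset.sum_const, Finset.card_univ, nsmul_eq_mul, ← hn] at h1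
    have h3 := mul_le_mul_of_nonneg_left h1 (show 0 ≤ C⁻¹ * n ^ (-beta p) by positivity)
    have h4 : C⁻¹ * n ^ (-beta p) * (C * n ^ (beta p - 1) *
        (n * energy p G f - ∑ u, energy p G (step p G f u))) =
        energy p G f - n⁻¹ * ∑ u, energy p G (step p G f u) := by
      rw [show C⁻¹ * n ^ (-beta p) * (C * n ^ (beta p - 1) *
        (n * energy p G f - ∑ u, energy p G (step p G f u))) =
        (C⁻¹ * C) * (n ^ (beta p - 1) * n ^ (-beta p)) *
        (n * energy p G f - ∑ u, energy p G (step p G f u)) by ring, h2]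
      field_simp
    rw [h4] at h3
    -- One step contracts the mean energy by 1 - n^(-β)/C, which is at most the exponential.
    have h5 := Real.add_one_le_exp (-(C⁻¹ * n ^ (-beta p)))
    have h6 := mul_le_mul_of_nonneg_right h5 (energy_nonneg p G f)
    linarith
  induction t with
  | zero => simp [profile]
  | succ t ih =>
    rw [integral_profile_succ p G f₀ hU]
    calc ∫ ω, n⁻¹ * ∑ u, energy p G (step p G (profile p G f₀ (fun s => v s ω) t) u) ∂P
        ≤ ∫ ω, Real.exp (-(C⁻¹ * n ^ (-beta p))) *
            energy p G (profile p G f₀ (fun s => v s ω) t) ∂P :=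
          integral_mono
            (integrable_profile_comp p G f₀ hU.measurable t
              fun g => n⁻¹ * ∑ u, energy p G (step p G g u))
            ((integrable_profile_comp p G f₀ hU.measurable t (energy p G)).const_mul _)
            fun ω => hstep _
      _ ≤ Real.exp (-(C⁻¹ * n ^ (-beta p))) *
            (Real.exp (-(C⁻¹ * n ^ (-beta p) * t)) * energy p G f₀) := by
          rw [integral_const_mul]
          exact mul_le_mul_of_nonneg_left ih (Real.exp_pos _).le
      _ = _ := by
          rw [← mul_assoc, ← Real.exp_add]; congr 2; push_cast; ring

theorem measurable_consensusTime [Nonempty V] (p : ℝ) (G : SimpleGraph V) (f₀ : V → ℝ)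
    (hv : ∀ t, Measurable (v t)) (ε : ℝ) :
    Measurable fun ω => consensusTime p G f₀ (fun s => v s ω) ε := by
  classical
  -- On the countable space `ℕ∞` both the Borel and the given σ-algebra contain every set; this
  -- makes the measurability of infima available.
  have : BorelSpace ℕ∞ := ⟨by
    rw [borel_eq_top_of_countable]
    exact MeasurableSpace.ext fun s => ⟨fun _ => trivial, fun _ => .of_discrete⟩⟩
  unfold consensusTime
  refine Measurable.iInf fun t => ?_
  simp only [iInf_eq_if]
  exact measurable_profile_comp p G f₀ hv t fun g => if osc g ≤ ε then (t : ℕ∞) else ⊤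

theorem lintegral_consensusTime_le [IsProbabilityMeasure P] {p κ : ℝ} (hp : 1 < p) (hκ : 0 < κ)
    {G : SimpleGraph V} (hG : G.Connected) {f₀ : V → ℝ} (hf₀ : ∀ x, f₀ x ∈ Set.Icc (0 : ℝ) 1)
    (hv : ∀ t, Measurable (v t))
    (hE : ∀ t : ℕ, ∫ ω, energy p G (profile p G f₀ (fun s => v s ω) t) ∂P ≤
      Real.exp (-(κ * t)) * energy p G f₀) {ε : ℝ} (hε : 0 < ε) (hε1 : ε ≤ 1) :
    ∫⁻ ω, (consensusTime p G f₀ (fun s => v s ω) ε : ℝ≥0∞) ∂P ≤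
      ENNReal.ofReal ((p + 2) * Real.log (Fintype.card V / ε) / κ + 2 + 1 / κ) := by
  classical
  have := hG.nonempty
  set n : ℝ := (Fintype.card V : ℝ) with hn
  have hn1 : 1 ≤ n := Nat.one_le_cast.mpr Fintype.card_pos
  have hn0 : 0 < n := by linarith
  have hq1 : 1 ≤ n / ε := by rw [le_div_iff₀ hε]; linarith
  have hmeas : ∀ t, Measurable fun ω =>
      if ε < osc (profile p G f₀ (fun s => v s ω) t) then (1 : ℝ≥0∞) else 0 := fun t =>
    measurable_profile_comp p G f₀ hv t fun g => if ε < osc g then (1 : ℝ≥0∞) else 0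
  refine (lintegral_mono fun ω => consensusTime_le_tsum p G f₀ (fun s => v s ω) ε).trans ?_
  rw [lintegral_tsum fun t => (hmeas t).aemeasurable, ← Real.log_rpow (by positivity)]
  -- The prefactor W = (n/ε)^(p+2) combines the threshold (ε/n)^p of Markov's inequality with the
  -- bound n² on the initial energy.
  refine tsum_le_of_exp_bound hκ (Real.one_le_rpow hq1 (by linarith)) (fun t => ?_) fun t => ?_
  · refine (lintegral_mono (g := fun _ => 1) fun ω => ?_).trans (by simp)
    beta_reduce; split_ifs <;> simp
  · set E := fun ω => energy p G (profile p G f₀ (fun s => v s ω) t) with hEdef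
    set a := (ε / n) ^ p with ha
    have ha0 : 0 < a := by positivity
    have hE0 : ∀ ω, 0 ≤ E ω := fun ω => energy_nonneg _ _ _
    calc ∫⁻ ω, (if ε < osc (profile p G f₀ (fun s => v s ω) t) then (1 : ℝ≥0∞) else 0) ∂P
        ≤ ∫⁻ ω, ENNReal.ofReal (E ω / a) ∂P := by
          refine lintegral_mono fun ω => ?_
          beta_reduce
          split_ifs with h
          · rw [ENNReal.one_le_ofReal, one_le_div ha0]
            exact rpow_le_energy_of_lt_osc hp hG hε h
          · exact zero_le
      _ = ENNReal.ofReal (∫ ω, E ω / a ∂P) := by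
          rw [ofReal_integral_eq_lintegral_ofReal
            ((integrable_profile_comp p G f₀ hv t (energy p G)).div_const a)
            (ae_of_all _ fun ω => div_nonneg (hE0 ω) ha0.le)]
      _ ≤ _ := by
          refine ENNReal.ofReal_le_ofReal ?_
          rw [integral_div, div_le_iff₀ ha0]
          refine (hE t).trans ?_
          rw [mul_assoc]
          refine mul_le_mul_of_nonneg_left ((energy_le_sq hp G hf₀).trans ?_) (Real.exp_pos _).le
          have h1 : (n / ε) ^ (p + 2) = (n / ε) ^ p * (n / ε) ^ 2 := by
            rw [Real.rpow_add (by positivity), Real.rpow_two]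
          have h2 : (n / ε) ^ p * a = 1 := by
            rw [ha, ← Real.mul_rpow (by positivity) (by positivity)]
            field_simp; simp
          rw [h1, mul_right_comm, h2, one_mul]
          refine pow_le_pow_left₀ hn0.le ?_ 2
          rw [le_div_iff₀ hε]
          nlinarith

theorem exists_energy_and_consensusTime_bounds {p : ℝ} (hp : 1 < p) :
    ∃ C c : ℝ, 0 < C ∧ 0 < c ∧
      ∀ (V : Type*) [Fintype V] [MeasurableSpace V] [DiscreteMeasurableSpace V]
        (G : SimpleGraph V), G.Connected → 2 ≤ Fintype.card V →
      ∀ f₀ : V → ℝ, (∀ x, f₀ x ∈ Set.Icc (0 : ℝ) 1) →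
      ∀ (Ω : Type*) [MeasurableSpace Ω] (P : Measure Ω) [IsProbabilityMeasure P]
        (v : ℕ → Ω → V), IsUniformUpdates P v →
        (∀ t : ℕ,
          Integrable (fun ω => energy p G (profile p G f₀ (fun s => v s ω) t)) P ∧
          ∫ ω, energy p G (profile p G f₀ (fun s => v s ω) t) ∂P ≤
            Real.exp (-(c * (Fintype.card V : ℝ) ^ (-beta p) * t)) * energy p G f₀) ∧
        (∀ ε : ℝ, 0 < ε → ε ≤ 1 / 2 →
          Measurable (fun ω => consensusTime p G f₀ (fun s => v s ω) ε) ∧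
          ∫⁻ ω, (consensusTime p G f₀ (fun s => v s ω) ε : ℝ≥0∞) ∂P ≤
            ENNReal.ofReal (C * (Fintype.card V : ℝ) ^ beta p *
              Real.log ((Fintype.card V : ℝ) / ε))) := by
  obtain ⟨C, hC, H⟩ := exists_energy_le_sum_drop hp
  refine ⟨(p + 3) * C + 2, C⁻¹, by positivity, by positivity, ?_⟩
  intro V _ _ _ G hG hcard f₀ hf₀ Ω _ P _ v hU
  have := hG.nonempty
  set n : ℝ := (Fintype.card V : ℝ) with hn
  have hn2 : 2 ≤ n := by rw [hn]; exact_mod_cast hcard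
  have hn0 : 0 < n := by linarith
  have hE := integral_energy_le hC (H V G hG) f₀ hU
  refine ⟨fun t => ⟨integrable_profile_comp p G f₀ hU.measurable t (energy p G), hE t⟩,
    fun ε hε hε2 => ⟨measurable_consensusTime p G f₀ hU.measurable ε, ?_⟩⟩
  refine (lintegral_consensusTime_le hp (show 0 < C⁻¹ * n ^ (-beta p) by positivity)
    hG hf₀ hU.measurable hE hε (by linarith)).trans (ENNReal.ofReal_le_ofReal ?_)
  rw [← hn]
  -- Since n ≥ 2 and ε ≤ 1/2, n/ε ≥ 4 > e; so the terms without a logarithm can be absorbed.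
  have hlog : 1 ≤ Real.log (n / ε) := by
    rw [Real.le_log_iff_exp_le (by positivity), le_div_iff₀ hε]
    have := Real.exp_one_lt_d9
    nlinarith [Real.exp_pos 1]
  have hb : 0 ≤ beta p := le_trans (by norm_num) (le_max_right (2 * p / (p - 1)) 3)
  have hnb : 1 ≤ n ^ beta p := Real.one_le_rpow (by linarith) hb
  have hinv : 1 / (C⁻¹ * n ^ (-beta p)) = C * n ^ beta p := by
    rw [Real.rpow_neg hn0.le]; field_simp
  rw [div_eq_mul_one_div, hinv]
  set l := Real.log (n / ε)
  set B := n ^ beta p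
  have h1 : C * B ≤ C * B * l := le_mul_of_one_le_right (by positivity) hlog
  have h2 : 1 ≤ B * l := by nlinarith
  nlinarith

end Measure

end Random

end LpConsensus

/-! ### Supersolutions and symmetries of the dynamics -/

namespace LpConsensus

section Comparison

variable {V : Type*} [Fintype V]

theorem profile_add (p : ℝ) (G : SimpleGraph V) (f₀ : V → ℝ) (v : ℕ → V) (s j : ℕ) :
    profile p G f₀ v (s + j) = profile p G (profile p G f₀ v s) (fun i => v (s + i)) j := by
  induction j with
  | zero => rfl
  | succ j ih => rw [← add_assoc]; simp only [profile, ih]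

/-- Balance of forces at y: only z may pull upward, with force at most e^(p-1), while each vertex of
A pulls down with force at least a^(p-1). -/
theorem flux_nonpos_of_card {p : ℝ} (hp : 1 < p) (G : SimpleGraph V) {f : V → ℝ} {v z : V}
    {A : Finset V} {y a e : ℝ} (ha : 0 ≤ a) (he : 0 ≤ e)
    (hAv : ∀ w ∈ A, G.Adj v w) (hzA : z ∉ A) (hA : ∀ w ∈ A, f w ≤ y - a)
    (hle : ∀ w, G.Adj v w → w ≠ z → f w ≤ y) (hz : f z ≤ y + e)
    (hcard : e ^ (p - 1) ≤ A.card * a ^ (p - 1)) : flux p G f v y ≤ 0 := by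
  classical
  unfold flux
  rw [sum_neighborFinset_eq]
  have h1 : ∀ w, (if G.Adj v w then phi p (f w - y) else 0) ≤
      (if w ∈ A then -a ^ (p - 1) else 0) + if w = z then e ^ (p - 1) else 0 := by
    intro w
    by_cases hwz : w = z
    · rw [hwz, if_neg hzA, if_pos rfl, zero_add]
      split_ifs
      · rw [← phi_of_nonneg p he]; exact phi_mono hp (by linarith)
      · positivity
    · rw [if_neg hwz, add_zero]
      by_cases hwA : w ∈ A
      · rw [if_pos (hAv w hwA), if_pos hwA, ← phi_of_nonneg p ha, ← phi_neg hp]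
        exact phi_mono hp (by linarith [hA w hwA])
      · rw [if_neg hwA]
        split_ifs with h
        · exact phi_nonpos hp (by linarith [hle w h hwz])
        · exact le_rfl
  refine (Finset.sum_le_sum fun w _ => h1 w).trans ?_
  rw [Finset.sum_add_distrib, Finset.sum_ite_eq', Finset.sum_ite_mem, Finset.univ_inter,
    Finset.sum_const, nsmul_eq_mul]
  simp only [Finset.mem_univ, if_true]
  linarith

theorem step_le_of_flux_nonpos {p : ℝ} (hp : 1 < p) (G : SimpleGraph V) {f b : V → ℝ} {v w : V}
    (hvw : G.Adj v w) (hfb : ∀ u, f u ≤ b u) (h : flux p G f v (b v) ≤ 0) (u : V) :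
    step p G f v u ≤ b u := by
  by_cases huv : u = v
  · rw [huv, step_self]; exact argmin_le hp G f hvw h
  · rw [step_of_ne p G f huv]; exact hfb u

theorem argmin_one_sub {p : ℝ} (hp : 1 < p) {G : SimpleGraph V} (σ : G ≃g G) (f : V → ℝ) {v w : V}
    (hvw : G.Adj v w) :
    argmin p G (fun u => 1 - f (σ u)) v = 1 - argmin p G f (σ v) := by
  classical
  have h : ∀ y, localSum p G (fun u => 1 - f (σ u)) v y = localSum p G f (σ v) (1 - y) := by
    intro y
    unfold localSum
    rw [sum_neighborFinset_eq, sum_neighborFinset_eq, ← Equiv.sum_comp σ.toEquiv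
      fun u => if G.Adj (σ v) u then |f u - (1 - y)| ^ p else 0]
    refine Finset.sum_congr rfl fun u _ => ?_
    have h1 : G.Adj (σ v) (σ.toEquiv u) ↔ G.Adj v u := σ.map_adj_iff
    have h2 : |1 - f (σ u) - y| = |f (σ.toEquiv u) - (1 - y)| := by
      rw [← abs_neg]; congr 1
      change -(1 - f (σ u) - y) = f (σ u) - (1 - y)
      ring
    simp only [h1, h2]
  symm
  refine eq_argmin hp G _ hvw fun z => ?_
  rw [h, h, sub_sub_cancel]
  exact localSum_argmin_le hp G f (σ v) _

/-- The dynamics commute with y ↦ 1 - y and with graph automorphisms, provided the update sequence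
is moved along. Bounds valid for all sequences therefore transfer to the reflected clique. -/
theorem profile_one_sub {p : ℝ} (hp : 1 < p) {G : SimpleGraph V} (hG : ∀ v, ∃ w, G.Adj v w)
    (σ : G ≃g G) (f₀ : V → ℝ) (v : ℕ → V) (t : ℕ) (u : V) :
    profile p G (fun u => 1 - f₀ (σ u)) v t u = 1 - profile p G f₀ (fun s => σ (v s)) t (σ u) := by
  induction t generalizing u with
  | zero => rfl
  | succ t ih =>
    simp only [profile]
    rw [show profile p G (fun u => 1 - f₀ (σ u)) v t =
      fun u => 1 - profile p G f₀ (fun s => σ (v s)) t (σ u) from funext ih]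
    by_cases huv : u = v t
    · obtain ⟨w, hw⟩ := hG (v t)
      rw [huv, step_self, step_self, argmin_one_sub hp σ _ hw]
    · rw [step_of_ne p G _ huv, step_of_ne p G _ (σ.injective.ne huv)]

end Comparison

/-! ### The barbell: a barrier that rises by ζ per k/2 updates -/

section Barbell

theorem barbell_adj {k : ℕ} {i j : Fin (4 * k - 1)} : (barbell k).Adj i j ↔ i ≠ j ∧
    (((i : ℕ) < k ∧ (j : ℕ) < k) ∨ (3 * k ≤ (i : ℕ) + 1 ∧ 3 * k ≤ (j : ℕ) + 1) ∨
      (i : ℕ) + 1 = j ∨ (j : ℕ) + 1 = i) := Iff.rfl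

theorem barbell_connected {k : ℕ} (hk : 2 ≤ k) : (barbell k).Connected := by
  have : Nonempty (Fin (4 * k - 1)) := ⟨⟨0, by omega⟩⟩
  refine ⟨(SimpleGraph.pathGraph_preconnected (4 * k - 1)).mono fun i j h => ?_⟩
  rw [SimpleGraph.pathGraph_adj] at h
  rw [barbell_adj]
  exact ⟨fun hij => by rw [hij] at h; omega, Or.inr (Or.inr h)⟩

theorem barbell_exists_adj {k : ℕ} (hk : 2 ≤ k) (v : Fin (4 * k - 1)) :
    ∃ w, (barbell k).Adj v w := by
  have hv := v.2
  by_cases h : (v : ℕ) + 1 < 4 * k - 1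
  · exact ⟨⟨v + 1, h⟩, barbell_adj.mpr ⟨fun e => by simpa using congrArg Fin.val e, by simp⟩⟩
  · refine ⟨⟨v - 1, by omega⟩, barbell_adj.mpr ⟨fun e => ?_, ?_⟩⟩
    · have := congrArg Fin.val e
      simp only at this; omega
    · simp only; omega

/-- The reflection of the barbell. -/
def barbellRev (k : ℕ) : barbell k ≃g barbell k where
  toEquiv := Fin.revPerm
  map_rel_iff' := by
    intro i j
    have hi := i.2
    have hj := j.2
    simp only [barbell_adj, Fin.revPerm_apply, Fin.val_rev, ne_eq, Fin.ext_iff]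
    omega

/-- The profile that vanishes on the left clique, equals `1` on the right clique and is linear
on the segment. -/
noncomputable def barbellProfile (k : ℕ) (i : Fin (4 * k - 1)) : ℝ :=
  min 1 (((i + 1 - k : ℕ) : ℝ) / (2 * k))

/-- A supersolution: it equals `x` on the left clique except at the endpoint of the segment, and
on the segment it is linear from `x + η` to `1`. -/
noncomputable def barrier (k : ℕ) (η x : ℝ) (i : Fin (4 * k - 1)) : ℝ :=
  if (i : ℕ) + 1 < k then x
  else min 1 (x + η + ((i : ℝ) + 1 - k) * ((1 - x - η) / (2 * k)))

/-- On the segment the value is the interpolation between x + η and 1, which increases with x;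
beyond the segment the cap at 1 takes over. -/
theorem barrier_mono {k : ℕ} (hk : 2 ≤ k) {η x x' : ℝ} (hxx : x ≤ x') (hx : x' + η ≤ 1)
    (i : Fin (4 * k - 1)) : barrier k η x i ≤ barrier k η x' i := by
  unfold barrier
  have hk0 : (0 : ℝ) < 2 * k := by positivity
  split_ifs with h
  · exact hxx
  · have hi : (k : ℝ) ≤ i + 1 := by exact_mod_cast not_lt.mp h
    refine le_min (min_le_left _ _) ?_
    rcases le_total ((i : ℝ) + 1 - k) (2 * k) with ht | ht
    · refine (min_le_right _ _).trans ?_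
      have h1 : ((i : ℝ) + 1 - k) / (2 * k) ≤ 1 := (div_le_one hk0).mpr ht
      have h2 : ∀ z : ℝ, z + η + ((i : ℝ) + 1 - k) * ((1 - z - η) / (2 * k)) =
        z + η + (((i : ℝ) + 1 - k) / (2 * k)) * (1 - z - η) := fun z => by ring
      rw [h2, h2]
      nlinarith
    · refine (min_le_left _ _).trans ?_
      have h1 : 1 ≤ ((i : ℝ) + 1 - k) / (2 * k) := (one_le_div hk0).mpr ht
      have h2 : x' + η + ((i : ℝ) + 1 - k) * ((1 - x' - η) / (2 * k)) =
        x' + η + (((i : ℝ) + 1 - k) / (2 * k)) * (1 - x' - η) := by ring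
      rw [h2]
      nlinarith

theorem barrier_le_one {k : ℕ} {η x : ℝ} (hx : x ≤ 1) (i : Fin (4 * k - 1)) :
    barrier k η x i ≤ 1 := by
  unfold barrier; split_ifs
  · exact hx
  · exact min_le_left _ _

theorem barbellProfile_le_barrier {k : ℕ} (hk : 2 ≤ k) {η : ℝ} (hη : 0 ≤ η) (hη1 : η ≤ 1)
    (i : Fin (4 * k - 1)) : barbellProfile k i ≤ barrier k η 0 i := by
  have h0 : barbellProfile k i ≤ barrier k 0 0 i := by
    unfold barbellProfile barrier
    split_ifs with h
    · rw [Nat.sub_eq_zero_of_le h.le]; simp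
    · rw [Nat.cast_sub (not_lt.mp h)]
      push_cast
      refine le_of_eq ?_
      congr 1; ring
  refine h0.trans ?_
  -- Off the left clique, offset 0 with level η and offset η with level 0 give the same barrier.
  have h1 := barrier_mono hk hη (η := 0) (by linarith) i
  unfold barrier at h1 ⊢
  split_ifs with h
  · exact le_rfl
  · rw [if_neg h, if_neg h] at h1
    rwa [show η + 0 + ((i : ℝ) + 1 - k) * ((1 - η - 0) / (2 * k)) =
      0 + η + ((i : ℝ) + 1 - k) * ((1 - 0 - η) / (2 * k)) by ring] at h1

theorem barbellProfile_rev {k : ℕ} (hk : 2 ≤ k) (i : Fin (4 * k - 1)) :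
    1 - barbellProfile k (barbellRev k i) = barbellProfile k i := by
  have hi := i.2
  have hk0 : (0 : ℝ) < 2 * k := by positivity
  have hrev : ((barbellRev k i : Fin (4 * k - 1)) : ℕ) = 4 * k - 1 - (i + 1) := rfl
  unfold barbellProfile
  rw [hrev]
  have hsmall : ∀ j : ℕ, j ≤ 2 * k → min 1 ((j : ℝ) / (2 * k)) = j / (2 * k) := fun j hj =>
    min_eq_right ((div_le_one hk0).mpr (by exact_mod_cast hj))
  have hlarge : ∀ j : ℕ, 2 * k ≤ j → min 1 ((j : ℝ) / (2 * k)) = 1 := fun j hj =>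
    min_eq_left ((one_le_div hk0).mpr (by exact_mod_cast hj))
  rcases le_total ((i : ℕ) + 1) k with h | h
  · rw [hlarge _ (by omega), Nat.sub_eq_zero_of_le h]; simp
  · rcases le_total (3 * k) ((i : ℕ) + 1) with h' | h'
    · rw [hlarge (i + 1 - k) (by omega), show 4 * k - 1 - ((i : ℕ) + 1) + 1 - k = 0 by omega]
      simp
    · rw [hsmall _ (by omega), hsmall _ (by omega), eq_div_iff hk0.ne', sub_mul,
        div_mul_cancel₀ _ hk0.ne', one_mul]
      have : 4 * k - 1 - ((i : ℕ) + 1) + 1 - k + (i + 1 - k) = 2 * k := by omega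
      have h2 : ((4 * k - 1 - ((i : ℕ) + 1) + 1 - k : ℕ) : ℝ) + ((i + 1 - k : ℕ) : ℝ) = 2 * k := by
        exact_mod_cast this
      linarith

theorem card_left {k : ℕ} (hk : 2 ≤ k) :
    (Finset.univ.filter fun i : Fin (4 * k - 1) => (i : ℕ) + 1 < k).card = k - 1 := by
  have h : (Finset.univ.filter fun i : Fin (4 * k - 1) => (i : ℕ) + 1 < k) =
      Finset.univ.filter fun i : Fin (4 * k - 1) => (i : ℕ) < k - 1 := by
    ext i; simp only [Finset.mem_filter, Finset.mem_univ, true_and]; omega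
  rw [h, Fin.card_filter_val_lt]
  omega

/-- The set U stands for the vertices updated since the clique was last known to lie below x. Fewer
than k/2 of them leave at least k/4 clique vertices at level x, and `h2` says that these outweigh
the pull η of the segment's endpoint. At the endpoint, `h1` balances the k - 1 clique neighbours at
depth η against the slope of the segment. -/
theorem step_le_barrier {p : ℝ} (hp : 1 < p) {k : ℕ} (hk : 4 ≤ k) {η ζ x : ℝ} (hη : 0 ≤ η)
    (hζ : 0 ≤ ζ) (hx0 : 0 ≤ x) (hx : x + ζ + η ≤ 1)
    (h1 : (1 / (2 * k) : ℝ) ^ (p - 1) ≤ (k - 1) * η ^ (p - 1))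
    (h2 : η ^ (p - 1) ≤ k / 4 * ζ ^ (p - 1)) {f : Fin (4 * k - 1) → ℝ}
    (hf : ∀ i, f i ≤ barrier k η (x + ζ) i) {U : Finset (Fin (4 * k - 1))} (hU : U.card < k / 2)
    (hfU : ∀ i : Fin (4 * k - 1), (i : ℕ) + 1 < k → i ∉ U → f i ≤ x) (v i : Fin (4 * k - 1)) :
    step p (barbell k) f v i ≤ barrier k η (x + ζ) i := by
  obtain ⟨w₀, hw₀⟩ := barbell_exists_adj (by omega : 2 ≤ k) v
  refine step_le_of_flux_nonpos hp _ hw₀ hf ?_ i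
  have hk0 : (0 : ℝ) < 2 * k := by positivity
  set x' := x + ζ with hx'
  set s := (1 - x' - η) / (2 * k) with hs
  have hs0 : 0 ≤ s := div_nonneg (by linarith) hk0.le
  have hs1 : s ≤ 1 / (2 * k) := by
    rw [hs]; exact div_le_div_of_nonneg_right (by linarith) hk0.le
  have hleft : ∀ j : Fin (4 * k - 1), (j : ℕ) + 1 < k → barrier k η x' j = x' := fun j hj =>
    if_pos hj
  have hline : ∀ j : Fin (4 * k - 1), k ≤ (j : ℕ) + 1 →
      barrier k η x' j ≤ x' + η + ((j : ℝ) + 1 - k) * s := fun j hj => by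
    unfold barrier; rw [if_neg (by omega)]; exact min_le_right _ _
  have hv := v.2
  rcases lt_trichotomy ((v : ℕ) + 1) k with hvk | hvk | hvk
  · rw [hleft v hvk]
    set A := ((Finset.univ.filter fun i : Fin (4 * k - 1) => (i : ℕ) + 1 < k) \ U).erase v with hA
    have hmem : ∀ w ∈ A, w ≠ v ∧ (w : ℕ) + 1 < k ∧ w ∉ U := fun w hw => by
      simpa [hA, and_assoc] using hw
    have hcard : (k : ℝ) / 4 ≤ A.card := by
      have e1 := Finset.pred_card_le_card_erase
        (s := (Finset.univ.filter fun i : Fin (4 * k - 1) => (i : ℕ) + 1 < k) \ U) (a := v)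
      have e2 := Finset.le_card_sdiff U
        (Finset.univ.filter fun i : Fin (4 * k - 1) => (i : ℕ) + 1 < k)
      rw [card_left (by omega)] at e2
      rw [← hA] at e1
      have e3 : k ≤ 4 * A.card := by omega
      have e4 : (k : ℝ) ≤ 4 * A.card := by exact_mod_cast e3
      linarith
    refine flux_nonpos_of_card hp (barbell k) (z := ⟨k - 1, by omega⟩) (A := A) (a := ζ) (e := η)
      hζ hη ?_ ?_ ?_ ?_ ?_ ?_
    · intro w hw
      obtain ⟨h3, h4, -⟩ := hmem w hw
      exact barbell_adj.mpr ⟨h3.symm, Or.inl ⟨by omega, by omega⟩⟩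
    · intro hz
      have := (hmem _ hz).2.1
      simp only at this; omega
    · intro w hw
      obtain ⟨-, h4, h5⟩ := hmem w hw
      linarith [hfU w h4 h5]
    · intro w hw hne
      have h3 : (w : ℕ) ≠ k - 1 := fun e => hne (Fin.ext e)
      have h4 := barbell_adj.mp hw
      have h5 : (w : ℕ) + 1 < k := by omega
      rw [← hleft w h5]; exact hf w
    · refine (hf _).trans ((hline _ ?_).trans (le_of_eq ?_))
      · simp only; omega
      · rw [show (((⟨k - 1, by omega⟩ : Fin (4 * k - 1)) : ℕ) : ℝ) = (k : ℝ) - 1 by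
          simp only; rw [Nat.cast_sub (by omega)]; simp]
        ring
    · exact h2.trans (mul_le_mul_of_nonneg_right hcard (by positivity))
  · have hvR : (v : ℝ) + 1 - k = 0 := by
      have : ((v : ℕ) : ℝ) + 1 = k := by exact_mod_cast hvk
      linarith
    have hbv : barrier k η x' v = x' + η := by
      unfold barrier
      rw [if_neg (by omega), hvR, zero_mul, add_zero, min_eq_right (by linarith)]
    rw [hbv]
    refine flux_nonpos_of_card hp (barbell k) (z := ⟨k, by omega⟩)
      (A := Finset.univ.filter fun i : Fin (4 * k - 1) => (i : ℕ) + 1 < k)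
      (a := η) (e := 1 / (2 * k)) hη (by positivity) ?_ ?_ ?_ ?_ ?_ ?_
    · intro w hw
      have hw' : (w : ℕ) + 1 < k := by simpa using hw
      exact barbell_adj.mpr ⟨fun e => by rw [e] at hvk; omega, Or.inl ⟨by omega, by omega⟩⟩
    · simp
    · intro w hw
      have hw' : (w : ℕ) + 1 < k := by simpa using hw
      have := hf w
      rw [hleft w hw'] at this
      linarith
    · intro w hw hne
      have h3 : (w : ℕ) ≠ k := fun e => hne (Fin.ext e)
      have h4 := barbell_adj.mp hw
      have h6 : (v : ℕ) ≠ w := fun e => h4.1 (Fin.ext e)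
      have h5 : (w : ℕ) + 1 < k := by omega
      have := hf w
      rw [hleft w h5] at this
      linarith
    · refine (hf _).trans ((hline _ ?_).trans ?_)
      · simp only; omega
      · simp only
        linarith
    · rw [card_left (by omega), Nat.cast_sub (by omega), Nat.cast_one]; exact h1
  · have hvR : (k : ℝ) + 1 ≤ (v : ℝ) + 1 := by exact_mod_cast hvk
    have hbv : barrier k η x' v = min 1 (x' + η + ((v : ℝ) + 1 - k) * s) := by
      unfold barrier; rw [if_neg (by omega)]
    -- At the cap every neighbour lies at or below 1. Otherwise v is interior to the segment, where
    -- the barrier at v ± 1 lies under a line of slope s, so the two pulls balance.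
    rcases le_or_gt 1 (x' + η + ((v : ℝ) + 1 - k) * s) with hcase | hcase
    · rw [hbv, min_eq_left hcase]
      unfold flux
      exact Finset.sum_nonpos fun w _ => phi_nonpos hp
        (by linarith [(hf w).trans (barrier_le_one (by linarith) w)])
    · rw [hbv, min_eq_right hcase.le]
      have hv3 : (v : ℕ) + 1 < 3 * k := by
        by_contra! hcon
        have h3 : (2 * k : ℝ) ≤ (v : ℝ) + 1 - k := by
          have : ((3 * k : ℕ) : ℝ) ≤ ((v : ℕ) + 1 : ℕ) := by exact_mod_cast hcon
          push_cast at this; linarith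
        have h4 := mul_le_mul_of_nonneg_right h3 hs0
        have h5 : (2 * k : ℝ) * s = 1 - x' - η := by rw [hs]; field_simp
        linarith
      refine flux_nonpos_of_card hp (barbell k) (z := ⟨v + 1, by omega⟩)
        (A := {⟨v - 1, by omega⟩}) (a := s) (e := s) hs0 hs0 ?_ ?_ ?_ ?_ ?_ ?_
      · intro w hw
        rw [Finset.mem_singleton] at hw
        rw [hw, barbell_adj]
        refine ⟨fun e => ?_, ?_⟩
        · have := congrArg Fin.val e
          simp only at this; omega
        · simp only; omega
      · rw [Finset.mem_singleton, Fin.ext_iff]; simp only; omega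
      · intro w hw
        rw [Finset.mem_singleton] at hw
        rw [hw]
        refine (hf _).trans ((hline _ ?_).trans (le_of_eq ?_))
        · simp only; omega
        · simp only
          rw [Nat.cast_sub (by omega)]; push_cast; ring
      · intro w hw hne
        have h4 := barbell_adj.mp hw
        have h3 : (w : ℕ) ≠ v + 1 := fun e => hne (Fin.ext e)
        have h5 : (w : ℕ) + 1 = v := by omega
        have h6 : (w : ℝ) + 1 = v := by exact_mod_cast h5
        refine (hf _).trans ((hline _ (by omega)).trans ?_)
        rw [h6]
        linarith
      · refine (hf _).trans ((hline _ ?_).trans (le_of_eq ?_))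
        · simp only; omega
        · simp only; push_cast; ring
      · simp

/-- During one phase the barrier is already raised to x + ζ, while clique vertices not updated in
this phase still satisfy the old bound x. -/
theorem profile_le_barrier_of_le_half {p : ℝ} (hp : 1 < p) {k : ℕ} (hk : 4 ≤ k) {η ζ x : ℝ}
    (hη : 0 ≤ η) (hζ : 0 ≤ ζ) (hx0 : 0 ≤ x) (hx : x + ζ + η ≤ 1)
    (h1 : (1 / (2 * k) : ℝ) ^ (p - 1) ≤ (k - 1) * η ^ (p - 1))
    (h2 : η ^ (p - 1) ≤ k / 4 * ζ ^ (p - 1)) {f : Fin (4 * k - 1) → ℝ}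
    (hf : ∀ i, f i ≤ barrier k η x i) (v : ℕ → Fin (4 * k - 1)) {j : ℕ} (hj : j ≤ k / 2)
    (i : Fin (4 * k - 1)) : profile p (barbell k) f v j i ≤ barrier k η (x + ζ) i := by
  have key : ∀ j ≤ k / 2, (∀ i, profile p (barbell k) f v j i ≤ barrier k η (x + ζ) i) ∧
      ∃ U : Finset (Fin (4 * k - 1)), U.card ≤ j ∧
        ∀ i : Fin (4 * k - 1), (i : ℕ) + 1 < k → i ∉ U → profile p (barbell k) f v j i ≤ x := by
    intro j
    induction j with
    | zero =>
      intro _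
      refine ⟨fun i => (hf i).trans (barrier_mono (by omega) (by linarith) hx i), ∅, by simp,
        fun i hi _ => (hf i).trans (le_of_eq (if_pos hi))⟩
    | succ j ih =>
      intro hj
      obtain ⟨ih1, U, hU, ih2⟩ := ih (by omega)
      refine ⟨step_le_barrier hp hk hη hζ hx0 hx h1 h2 ih1 (by omega : U.card < k / 2) ih2 (v j),
        insert (v j) U, (Finset.card_insert_le _ _).trans (by omega), fun i hi hiU => ?_⟩
      rw [Finset.mem_insert, not_or] at hiU
      simp only [profile]
      rw [step_of_ne p _ _ hiU.1]
      exact ih2 i hi hiU.2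
  exact (key j hj).1 i

theorem profile_le_barrier {p : ℝ} (hp : 1 < p) {k : ℕ} (hk : 4 ≤ k) {η ζ : ℝ}
    (hη : 0 ≤ η) (hη1 : η ≤ 1) (hζ : 0 ≤ ζ)
    (h1 : (1 / (2 * k) : ℝ) ^ (p - 1) ≤ (k - 1) * η ^ (p - 1))
    (h2 : η ^ (p - 1) ≤ k / 4 * ζ ^ (p - 1)) (v : ℕ → Fin (4 * k - 1)) (l : ℕ) {j : ℕ}
    (hj : j ≤ k / 2) (hl : (l + 1) * ζ + η ≤ 1) (i : Fin (4 * k - 1)) :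
    profile p (barbell k) (barbellProfile k) v (k / 2 * l + j) i ≤
      barrier k η ((l + 1) * ζ) i := by
  have key : ∀ l : ℕ, l * ζ + η ≤ 1 → ∀ i,
      profile p (barbell k) (barbellProfile k) v (k / 2 * l) i ≤ barrier k η (l * ζ) i := by
    intro l
    induction l with
    | zero =>
      intro _ i
      simpa [profile] using barbellProfile_le_barrier (by omega) hη hη1 i
    | succ l ih =>
      intro hl i
      push_cast at hl ⊢
      rw [mul_add, mul_one, profile_add, add_mul, one_mul]
      exact profile_le_barrier_of_le_half hp hk hη hζ (by positivity) (by linarith) h1 h2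
        (ih (by linarith)) _ le_rfl i
  rw [profile_add, add_mul, one_mul]
  exact profile_le_barrier_of_le_half hp hk hη hζ (by positivity) (by linarith) h1 h2
    (key l (by linarith)) _ hj i

theorem barbell_time_ge {p : ℝ} (hp : 1 < p) {k : ℕ} (hk : 4 ≤ k) {η ζ : ℝ}
    (hη : 0 ≤ η) (hη1 : η ≤ 1 / 8) (hζ : 0 < ζ) (hζ1 : ζ ≤ 1 / 8)
    (h1 : (1 / (2 * k) : ℝ) ^ (p - 1) ≤ (k - 1) * η ^ (p - 1))
    (h2 : η ^ (p - 1) ≤ k / 4 * ζ ^ (p - 1)) (v : ℕ → Fin (4 * k - 1)) {t : ℕ}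
    (ht : osc (profile p (barbell k) (barbellProfile k) v t) ≤ 1 / 2) :
    (k : ℝ) / 3 * (1 / (8 * ζ)) ≤ t := by
  have hm0 : 0 < k / 2 := by omega
  set l := t / (k / 2) with hl
  have htl : k / 2 * l + t % (k / 2) = t := Nat.div_add_mod t (k / 2)
  have hlz : 1 / 4 ≤ ((l : ℝ) + 1) * ζ := by
    -- Vertex 0 stays below 1/4 for every update sequence; by reflection the opposite vertex stays
    -- above 3/4, so the oscillation exceeds 1/2.
    by_contra! hcon
    have h3 : ∀ w : ℕ → Fin (4 * k - 1),
        profile p (barbell k) (barbellProfile k) w t ⟨0, by omega⟩ ≤ ((l : ℝ) + 1) * ζ := by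
      intro w
      have := profile_le_barrier hp hk hη (by linarith) hζ.le h1 h2 w l (j := t % (k / 2))
        (Nat.mod_lt _ hm0).le (by linarith) ⟨0, by omega⟩
      rw [htl] at this
      refine this.trans (le_of_eq (if_pos ?_))
      simp only; omega
    have h4 := profile_one_sub hp (barbell_exists_adj (by omega : 2 ≤ k)) (barbellRev k)
      (barbellProfile k) v t (barbellRev k ⟨0, by omega⟩)
    rw [show (fun u => 1 - barbellProfile k (barbellRev k u)) = barbellProfile k from
      funext (barbellProfile_rev (by omega))] at h4
    have h5 : barbellRev k (barbellRev k ⟨0, by omega⟩) = ⟨0, by omega⟩ := Fin.rev_rev _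
    rw [h5] at h4
    have h6 := sub_le_osc (profile p (barbell k) (barbellProfile k) v t) ⟨0, by omega⟩
      (barbellRev k ⟨0, by omega⟩)
    linarith [h3 v, h3 fun s => barbellRev k (v s)]
  have h7 : 1 / (8 * ζ) ≤ l := by
    rw [div_le_iff₀ (by positivity)]; linarith
  have h8 : (k : ℝ) / 3 ≤ (k / 2 : ℕ) := by
    have : k ≤ 3 * (k / 2) := by omega
    have : (k : ℝ) ≤ 3 * (k / 2 : ℕ) := by exact_mod_cast this
    linarith
  have h9 : ((k / 2 * l : ℕ) : ℝ) ≤ t := by exact_mod_cast (by omega : k / 2 * l ≤ t)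
  rw [Nat.cast_mul] at h9
  exact (mul_le_mul h8 h7 (by positivity) (by positivity)).trans h9

theorem isSlow_of_time_ge {V : Type*} [Fintype V] {p a : ℝ} {N : ℕ} {G : SimpleGraph V}
    (hG : G.Connected) (hN : Fintype.card V ≤ N) (f₀ : V → ℝ)
    (hf₀ : ∀ x, f₀ x ∈ Set.Icc (0 : ℝ) 1)
    (h : ∀ (v : ℕ → V) (t : ℕ), osc (profile p G f₀ v t) ≤ 1 / 2 → a * (N : ℝ) ^ beta p ≤ t) :
    IsSlow p a N G := by
  refine ⟨hG, hN, f₀, hf₀, fun v => ?_⟩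
  have h1 : ((⌈a * (N : ℝ) ^ beta p⌉₊ : ℕ) : ℕ∞) ≤ consensusTime p G f₀ v (1 / 2) :=
    natCast_le_consensusTime fun t ht => by exact_mod_cast Nat.ceil_le.mpr (h v t ht)
  refine le_trans ?_ (ENat.toENNReal_le.mpr h1)
  rw [ENat.toENNReal_coe, ← ENNReal.ofReal_natCast]
  exact ENNReal.ofReal_le_ofReal (Nat.le_ceil _)

theorem barbell_isSlow {p : ℝ} (hp : 1 < p) (hp3 : p ≤ 3) :
    ∃ a : ℝ, 0 < a ∧ ∀ᶠ N : ℕ in atTop, ∃ k : ℕ, 2 ≤ k ∧ IsSlow p a N (barbell k) := by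
  -- The time bound is k/3 · 1/(8ζ) = k² (k/4)^(2/(p-1)) / 12, and both k and k/4 are at least N/20.
  refine ⟨1 / 12 * (1 / 20) ^ beta p, by positivity, ?_⟩
  filter_upwards [eventually_ge_atTop 15] with N hN
  set k := (N + 1) / 4 with hk
  have hk4 : 4 ≤ k := by omega
  have hp1 : 0 < p - 1 := by linarith
  have hkR : (4 : ℝ) ≤ k := by exact_mod_cast hk4
  have hNk : (N : ℝ) ≤ 5 * k := by exact_mod_cast (by omega : N ≤ 5 * k)
  have hN0 : (0 : ℝ) ≤ N := by positivity
  refine ⟨k, by omega, isSlow_of_time_ge (barbell_connected (by omega)) ?_ (barbellProfile k)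
    (fun x => ⟨by unfold barbellProfile; positivity, min_le_left _ _⟩) fun v t ht => ?_⟩
  · rw [Fintype.card_fin]; omega
  -- Each passage, from slope 1/(2k) to η and from η to ζ, gains the factor q. The second balance is
  -- an equality; the first uses 4(k - 1) ≥ k.
  set q : ℝ := (4 / k) ^ (p - 1)⁻¹ with hq
  have hq0 : 0 < q := by positivity
  have hq1 : q ≤ 1 := Real.rpow_le_one (by positivity) ((div_le_one (by positivity)).mpr hkR)
    (by positivity)
  have hqp : q ^ (p - 1) = 4 / k := Real.rpow_inv_rpow (by positivity) hp1.ne'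
  have h8 : (1 : ℝ) / (2 * k) ≤ 1 / 8 := one_div_le_one_div_of_le (by norm_num) (by linarith)
  have hη : q * (1 / (2 * k)) ≤ 1 / 8 := by nlinarith
  have hζ : q * (q * (1 / (2 * k))) ≤ 1 / 8 := by
    have : 0 ≤ q * (1 / (2 * k)) := by positivity
    nlinarith
  have hmain := barbell_time_ge hp hk4 (η := q * (1 / (2 * k))) (ζ := q * (q * (1 / (2 * k))))
    (by positivity) hη (by positivity) hζ ?_ ?_ v ht
  · refine le_trans ?_ hmain
    have hb : beta p = 2 + 2 * (p - 1)⁻¹ := by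
      unfold beta
      rw [max_eq_left]
      · field_simp; ring
      · rw [le_div_iff₀ hp1]; linarith
    have hq2 : q * q = (k / 4 : ℝ) ^ (-(2 * (p - 1)⁻¹)) := by
      rw [hq, ← Real.rpow_add (by positivity), ← inv_div, Real.inv_rpow (by positivity),
        ← Real.rpow_neg (by positivity)]
      congr 1; ring
    have h9 : (k : ℝ) / 3 * (1 / (8 * (q * (q * (1 / (2 * k)))))) =
        1 / 12 * (k ^ 2 * (k / 4 : ℝ) ^ (2 * (p - 1)⁻¹)) := by
      rw [← mul_assoc q q, hq2, Real.rpow_neg (by positivity)]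
      have : (0 : ℝ) < (k / 4 : ℝ) ^ (2 * (p - 1)⁻¹) := by positivity
      field_simp
      ring
    rw [h9, mul_assoc, ← Real.mul_rpow (by norm_num) hN0, hb,
      Real.rpow_add_of_nonneg (by positivity) (by norm_num) (by positivity), Real.rpow_two]
    gcongr
    · linarith
    · linarith
  · rw [Real.mul_rpow hq0.le (by positivity), hqp, ← mul_assoc]
    refine le_mul_of_one_le_left (by positivity) ?_
    rw [mul_div_assoc', le_div_iff₀ (by positivity)]
    linarith
  · rw [Real.mul_rpow hq0.le (by positivity), Real.mul_rpow hq0.le (by positivity),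
      Real.mul_rpow hq0.le (by positivity), hqp]
    refine le_of_eq ?_
    field_simp

end Barbell

end LpConsensus

/-! ### The cycle: quadratic energy against total displacement -/

namespace LpConsensus

section Cycle

variable {n : ℕ}

theorem sum_cycle_neighborFinset (v : Fin (n + 3))
    {_ : Fintype ((SimpleGraph.cycleGraph (n + 3)).neighborSet v)} (g : Fin (n + 3) → ℝ) :
    ∑ w ∈ (SimpleGraph.cycleGraph (n + 3)).neighborFinset v, g w = g (v - 1) + g (v + 1) := by
  have h : (SimpleGraph.cycleGraph (n + 3)).neighborFinset v = {v - 1, v + 1} := by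
    ext w
    rw [SimpleGraph.mem_neighborFinset, SimpleGraph.cycleGraph_adj, Finset.mem_insert,
      Finset.mem_singleton]
    refine or_congr ⟨fun h => ?_, fun h => ?_⟩ ⟨fun h => ?_, fun h => ?_⟩
    · rw [← h]; abel
    · rw [h]; abel
    · rw [← h]; abel
    · rw [h]; abel
  rw [h, Finset.sum_pair]
  intro h
  -- The two neighbours coincide only if 2 = 0 modulo n + 3, which the size excludes.
  have h1 : (1 : Fin (n + 3)) + 1 = 0 := by
    have : v + 1 - (v - 1) = 0 := by rw [h, sub_self]
    rwa [show v + 1 - (v - 1) = 1 + 1 by abel] at this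
  have := congrArg Fin.val h1
  rw [Fin.val_add, Fin.val_one', Fin.val_zero, Nat.mod_eq_of_lt (by omega : 1 < n + 3),
    Nat.mod_eq_of_lt (by omega)] at this
  omega

theorem cycle_adj_add_one (v : Fin (n + 3)) :
    (SimpleGraph.cycleGraph (n + 3)).Adj v (v + 1) := by
  rw [SimpleGraph.cycleGraph_adj]; right; abel

/-- With two neighbours the contributions at the midpoint cancel because `phi` is odd, whatever p
is. The dynamics thus agree with those for p = 2. -/
theorem cycle_argmin {p : ℝ} (hp : 1 < p) (f : Fin (n + 3) → ℝ) (v : Fin (n + 3)) :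
    argmin p (SimpleGraph.cycleGraph (n + 3)) f v = (f (v - 1) + f (v + 1)) / 2 := by
  classical
  have h : flux p (SimpleGraph.cycleGraph (n + 3)) f v ((f (v - 1) + f (v + 1)) / 2) = 0 := by
    unfold flux
    rw [sum_cycle_neighborFinset v fun w => phi p (f w - (f (v - 1) + f (v + 1)) / 2),
      show f (v - 1) - (f (v - 1) + f (v + 1)) / 2 = -(f (v + 1) - (f (v - 1) + f (v + 1)) / 2) by
        ring, phi_neg hp]
    ring
  exact le_antisymm (argmin_le hp _ f (cycle_adj_add_one v) h.le)
    (le_argmin hp _ f (cycle_adj_add_one v) h.ge)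

theorem cycle_step_energy {p : ℝ} (hp : 1 < p) (f : Fin (n + 3) → ℝ) (v : Fin (n + 3)) :
    energy 2 (SimpleGraph.cycleGraph (n + 3)) f -
      energy 2 (SimpleGraph.cycleGraph (n + 3)) (step p (SimpleGraph.cycleGraph (n + 3)) f v) =
      2 * (step p (SimpleGraph.cycleGraph (n + 3)) f v v - f v) ^ 2 := by
  classical
  have hstep : step p (SimpleGraph.cycleGraph (n + 3)) f v =
      step 2 (SimpleGraph.cycleGraph (n + 3)) f v := by
    unfold step; rw [cycle_argmin hp, cycle_argmin one_lt_two]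
  rw [hstep, energy_sub_energy_step, step_self, cycle_argmin one_lt_two]
  unfold localSum
  rw [sum_cycle_neighborFinset v fun w => |f w - f v| ^ (2 : ℝ),
    sum_cycle_neighborFinset v fun w => |f w - (f (v - 1) + f (v + 1)) / 2| ^ (2 : ℝ)]
  simp only [Real.rpow_two, sq_abs]
  ring

/-- The ℓ¹ displacement is at most the sum of the t moves; twice the sum of their squares is the
loss of quadratic energy. Cauchy-Schwarz connects the two. -/
theorem cycle_displacement_sq_le {p : ℝ} (hp : 1 < p) (f₀ : Fin (n + 3) → ℝ)
    (v : ℕ → Fin (n + 3)) (t : ℕ) :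
    2 * (∑ u, |profile p (SimpleGraph.cycleGraph (n + 3)) f₀ v t u - f₀ u|) ^ 2 ≤
      t * energy 2 (SimpleGraph.cycleGraph (n + 3)) f₀ := by
  set G := SimpleGraph.cycleGraph (n + 3) with hG
  set F := profile p G f₀ v with hF
  set δ : ℕ → ℝ := fun s => |F (s + 1) (v s) - F s (v s)| with hδ
  have h1 : ∀ t : ℕ, ∑ u, |F t u - f₀ u| ≤ ∑ s ∈ Finset.range t, δ s := by
    intro t
    induction t with
    | zero => simp [hF, profile]
    | succ t ih =>
      rw [Finset.sum_range_succ]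
      have h2 : ∀ u, |F (t + 1) u - f₀ u| ≤ |F t u - f₀ u| + if u = v t then δ t else 0 := by
        intro u
        by_cases hu : u = v t
        · rw [if_pos hu, hu]
          exact (abs_sub_le _ (F t (v t)) _).trans (le_of_eq (add_comm _ _))
        · rw [if_neg hu, add_zero]
          have : F (t + 1) u = F t u := step_of_ne p G _ hu
          rw [this]
      refine (Finset.sum_le_sum fun u _ => h2 u).trans ?_
      rw [Finset.sum_add_distrib, Finset.sum_ite_eq']
      simpa using ih
  have h2 : ∀ t : ℕ, 2 * ∑ s ∈ Finset.range t, δ s ^ 2 = energy 2 G f₀ - energy 2 G (F t) := by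
    intro t
    induction t with
    | zero => simp [hF, profile]
    | succ t ih =>
      rw [Finset.sum_range_succ, mul_add, ih, hδ]
      simp only [sq_abs]
      have := cycle_step_energy hp (F t) (v t)
      change _ = 2 * (F (t + 1) (v t) - F t (v t)) ^ 2 at this
      rw [← this]
      change _ + (_ - energy 2 G (F (t + 1))) = _
      ring
  have h3 := sq_sum_le_card_mul_sum_sq (s := Finset.range t) (f := δ)
  rw [Finset.card_range] at h3
  have h4 := pow_le_pow_left₀
    (Finset.sum_nonneg fun u (_ : u ∈ Finset.univ) => abs_nonneg (F t u - f₀ u)) (h1 t) 2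
  have h5 : (t : ℝ) * (2 * ∑ s ∈ Finset.range t, δ s ^ 2) ≤ t * energy 2 G f₀ := by
    refine mul_le_mul_of_nonneg_left ?_ (by positivity)
    rw [h2]; linarith [energy_nonneg 2 G (F t)]
  linarith

/-- The distance to the vertex `0`, rescaled to take values in `[0, 1]`. -/
noncomputable def cycleProfile (m : ℕ) (j : Fin m) : ℝ := ((min (j : ℕ) (m - j) : ℕ) : ℝ) * (2 / m)

theorem cycleProfile_mem {m : ℕ} (j : Fin m) : cycleProfile m j ∈ Set.Icc (0 : ℝ) 1 := by
  have hj := j.2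
  have hm : (0 : ℝ) < m := Nat.cast_pos.mpr (by omega)
  refine ⟨by unfold cycleProfile; positivity, ?_⟩
  have h : 2 * min (j : ℕ) (m - j) ≤ m := by omega
  have h' : (2 : ℝ) * (min (j : ℕ) (m - j) : ℕ) ≤ m := by exact_mod_cast h
  unfold cycleProfile
  rw [mul_div_assoc', div_le_one hm]
  linarith

theorem cycleProfile_abs_sub_le (j : Fin (n + 3)) :
    |cycleProfile (n + 3) (j + 1) - cycleProfile (n + 3) j| ≤ 2 / (n + 3 : ℕ) := by
  unfold cycleProfile
  rw [← sub_mul, abs_mul, abs_of_nonneg (show (0 : ℝ) ≤ 2 / (n + 3 : ℕ) by positivity)]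
  refine mul_le_of_le_one_left (by positivity) ?_
  have hj := j.2
  have h : ((min ((j + 1 : Fin (n + 3)) : ℕ) (n + 3 - (j + 1 : Fin (n + 3))) : ℕ) : ℤ) ≤
      (min (j : ℕ) (n + 3 - j) : ℕ) + 1 ∧ ((min (j : ℕ) (n + 3 - j) : ℕ) : ℤ) ≤
      (min ((j + 1 : Fin (n + 3)) : ℕ) (n + 3 - (j + 1 : Fin (n + 3))) : ℕ) + 1 := by
    rw [Fin.val_add_one]
    split_ifs with h
    · rw [h, Fin.val_last]; omega
    · omega
  obtain ⟨h1, h2⟩ := h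
  have h1' := (Int.cast_le (R := ℝ)).mpr h1
  have h2' := (Int.cast_le (R := ℝ)).mpr h2
  simp only [Int.cast_natCast, Int.cast_add, Int.cast_one] at h1' h2'
  rw [abs_le]
  constructor <;> linarith

theorem energy_cycleProfile_le :
    energy 2 (SimpleGraph.cycleGraph (n + 3)) (cycleProfile (n + 3)) ≤ 4 / (n + 3 : ℕ) := by
  classical
  have h := two_mul_energy 2 (SimpleGraph.cycleGraph (n + 3)) (cycleProfile (n + 3))
  have h1 : ∀ v, localSum 2 (SimpleGraph.cycleGraph (n + 3)) (cycleProfile (n + 3)) v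
      (cycleProfile (n + 3) v) ≤ 2 * (2 / (n + 3 : ℕ)) ^ 2 := by
    intro v
    unfold localSum
    rw [sum_cycle_neighborFinset v fun w =>
      |cycleProfile (n + 3) w - cycleProfile (n + 3) v| ^ (2 : ℝ)]
    simp only [Real.rpow_two]
    have h2 := cycleProfile_abs_sub_le (v - 1)
    rw [sub_add_cancel, abs_sub_comm] at h2
    have h3 := pow_le_pow_left₀ (abs_nonneg _) h2 2
    have h4 := pow_le_pow_left₀ (abs_nonneg _) (cycleProfile_abs_sub_le v) 2
    linarith
  have h2 := Finset.sum_le_sum fun v (_ : v ∈ Finset.univ) => h1 v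
  rw [← h, Finset.sum_const, Finset.card_univ, Fintype.card_fin, nsmul_eq_mul] at h2
  have h3 : ((n + 3 : ℕ) : ℝ) * (2 * (2 / (n + 3 : ℕ)) ^ 2) = 2 * (4 / (n + 3 : ℕ)) := by
    have : ((n + 3 : ℕ) : ℝ) ≠ 0 := by positivity
    field_simp; norm_num
  rw [h3] at h2
  linarith

/-- The r vertices starting at 0 and the r vertices starting at the antipode 8r are paired.
Initially each pair differs by at least 3/4, finally by at most 1/2, so each pair contributes 1/4.
-/
theorem displacement_cycleProfile_ge {r : ℕ} (hr : 0 < r) {g : Fin (16 * r) → ℝ}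
    (hg : osc g ≤ 1 / 2) : (r : ℝ) / 4 ≤ ∑ u, |g u - cycleProfile (16 * r) u| := by
  have hr0 : (0 : ℝ) < r := by exact_mod_cast hr
  let a : Fin r → Fin (16 * r) := fun j => ⟨j, by omega⟩
  let b : Fin r → Fin (16 * r) := fun j => ⟨8 * r + j, by omega⟩
  set e := fun u => |g u - cycleProfile (16 * r) u| with he
  have h1 : ∀ j : Fin r, 1 / 4 ≤ e (a j) + e (b j) := by
    intro j
    have hj : (j : ℝ) ≤ r := by exact_mod_cast j.2.le
    have h2 : cycleProfile (16 * r) (a j) = j / (8 * r) := by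
      unfold cycleProfile
      rw [show min ((a j : Fin (16 * r)) : ℕ) (16 * r - (a j : Fin (16 * r))) = j from
        min_eq_left (by simp only [a]; omega)]
      push_cast; field_simp; ring
    have h3 : cycleProfile (16 * r) (b j) = 1 - j / (8 * r) := by
      unfold cycleProfile
      rw [show min ((b j : Fin (16 * r)) : ℕ) (16 * r - (b j : Fin (16 * r))) = 8 * r - j from by
        simp only [b]; omega, Nat.cast_sub (by omega)]
      push_cast; field_simp; ring
    have h4 : (j : ℝ) / (8 * r) ≤ 1 / 8 := by
      rw [div_le_div_iff₀ (by positivity) (by norm_num)]; linarith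
    have h5 := sub_le_osc g (a j) (b j)
    have h6 := le_abs_self (g (a j) - cycleProfile (16 * r) (a j))
    have h7 := neg_le_abs (g (b j) - cycleProfile (16 * r) (b j))
    simp only [he]
    linarith
  have h2 : (r : ℝ) / 4 ≤ ∑ j, e (a j) + ∑ j, e (b j) := by
    rw [← Finset.sum_add_distrib]
    refine le_trans (le_of_eq ?_) (Finset.sum_le_sum fun j _ => h1 j)
    rw [Finset.sum_const, Finset.card_univ, Fintype.card_fin, nsmul_eq_mul]; ring
  refine h2.trans ?_
  have h3 : ∑ j, e (a j) + ∑ j, e (b j) = ∑ x, e (Sum.elim a b x) := by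
    rw [Fintype.sum_sum_type]; rfl
  rw [h3]
  have hinj : Function.Injective (Sum.elim a b) := by
    rintro (i | i) (j | j) h <;> have h' := congrArg Fin.val h <;>
      simp only [Sum.elim_inl, Sum.elim_inr, a, b] at h'
    · exact congrArg _ (Fin.ext h')
    · omega
    · omega
    · exact congrArg _ (Fin.ext (by omega))
  refine (Finset.sum_map Finset.univ ⟨Sum.elim a b, hinj⟩ e).ge.trans ?_
  exact Finset.sum_le_univ_sum_of_nonneg fun u => abs_nonneg _

theorem cycle_time_ge {p : ℝ} (hp : 1 < p) {r : ℕ} (hr : 0 < r) (v : ℕ → Fin (16 * r)) {t : ℕ}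
    (ht : osc (profile p (SimpleGraph.cycleGraph (16 * r)) (cycleProfile (16 * r)) v t) ≤ 1 / 2) :
    (r : ℝ) ^ 3 / 2 ≤ t := by
  have hr0 : (0 : ℝ) < r := by exact_mod_cast hr
  have h1 := displacement_cycleProfile_ge hr ht
  have h2 : 2 * (∑ u, |profile p (SimpleGraph.cycleGraph (16 * r)) (cycleProfile (16 * r)) v t u -
      cycleProfile (16 * r) u|) ^ 2 ≤ t * (4 / (16 * r : ℕ)) := by
    -- The vertex type depends on 16 * r, so everything mentioning it is cleared or generalized
    -- before rewriting to the form n + 3.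
    obtain ⟨n, hn⟩ : ∃ n, 16 * r = n + 3 := ⟨16 * r - 3, by omega⟩
    clear h1 ht
    revert v
    rw [hn]
    intro v
    exact (cycle_displacement_sq_le hp _ v t).trans
      (mul_le_mul_of_nonneg_left energy_cycleProfile_le (by positivity))
  have h3 := pow_le_pow_left₀ (by positivity) h1 2
  have h4 : 2 * ((r : ℝ) / 4) ^ 2 ≤ t * (4 / (16 * r : ℕ)) := by linarith
  push_cast at h4
  rw [mul_div_assoc', le_div_iff₀ (by positivity)] at h4
  nlinarith

theorem cycle_isSlow {p : ℝ} (hp3 : 3 ≤ p) :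
    ∃ a : ℝ, 0 < a ∧ ∀ᶠ N : ℕ in atTop, ∃ m : ℕ, 3 ≤ m ∧
      IsSlow p a N (SimpleGraph.cycleGraph m) := by
  have hp : 1 < p := by linarith
  -- With r = N/16 rounded down and N ≥ 16, N ≤ 16r + 15 ≤ 31r.
  refine ⟨1 / 2 * (1 / 31) ^ 3, by positivity, ?_⟩
  filter_upwards [eventually_ge_atTop 16] with N hN
  have hr : 0 < N / 16 := by omega
  refine ⟨16 * (N / 16), by omega, isSlow_of_time_ge ?_ ?_ (cycleProfile _) cycleProfile_mem
    fun v t ht => le_trans ?_ (cycle_time_ge hp hr v ht)⟩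
  · obtain ⟨n, hn⟩ : ∃ n, 16 * (N / 16) = n + 1 := ⟨16 * (N / 16) - 1, by omega⟩
    rw [hn]; exact SimpleGraph.cycleGraph_connected
  · rw [Fintype.card_fin]; omega
  · have hb : beta p = (3 : ℕ) := by
      unfold beta
      rw [max_eq_right]
      · norm_num
      · rw [div_le_iff₀ (by linarith)]; linarith
    have hN' : (N : ℝ) ≤ 31 * (N / 16 : ℕ) := by exact_mod_cast (by omega : N ≤ 31 * (N / 16))
    rw [hb, Real.rpow_natCast, mul_assoc, ← mul_pow, one_div_mul_eq_div]
    refine div_le_div_of_nonneg_right (pow_le_pow_left₀ (by positivity) ?_ 3) (by norm_num)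
    linarith

theorem exists_isSlow {p : ℝ} (hp : 1 < p) : ∃ a : ℝ, 0 < a ∧
    (∀ᶠ N : ℕ in atTop, ∃ (n : ℕ) (G : SimpleGraph (Fin n)), IsSlow p a N G) ∧
    (p ≤ 3 → ∀ᶠ N : ℕ in atTop, ∃ k : ℕ, 2 ≤ k ∧ IsSlow p a N (barbell k)) ∧
    (3 ≤ p → ∀ᶠ N : ℕ in atTop, ∃ m : ℕ, 3 ≤ m ∧ IsSlow p a N (SimpleGraph.cycleGraph m)) := by
  have mono : ∀ {a b : ℝ} {N n : ℕ} {G : SimpleGraph (Fin n)}, a ≤ b → IsSlow p b N G →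
      IsSlow p a N G := by
    rintro a b N n G hab ⟨h1, h2, f₀, h3, h4⟩
    exact ⟨h1, h2, f₀, h3, fun v => (ENNReal.ofReal_le_ofReal
      (mul_le_mul_of_nonneg_right hab (by positivity))).trans (h4 v)⟩
  have hB : ∃ a : ℝ, 0 < a ∧ (p ≤ 3 → ∀ᶠ N : ℕ in atTop, ∃ k : ℕ, 2 ≤ k ∧
      IsSlow p a N (barbell k)) := by
    by_cases h : p ≤ 3
    · obtain ⟨a, ha, H⟩ := barbell_isSlow hp h; exact ⟨a, ha, fun _ => H⟩
    · exact ⟨1, one_pos, fun h' => absurd h' h⟩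
  have hC : ∃ a : ℝ, 0 < a ∧ (3 ≤ p → ∀ᶠ N : ℕ in atTop, ∃ m : ℕ, 3 ≤ m ∧
      IsSlow p a N (SimpleGraph.cycleGraph m)) := by
    by_cases h : 3 ≤ p
    · obtain ⟨a, ha, H⟩ := cycle_isSlow h; exact ⟨a, ha, fun _ => H⟩
    · exact ⟨1, one_pos, fun h' => absurd h' h⟩
  obtain ⟨a, ha, HB⟩ := hB
  obtain ⟨b, hb, HC⟩ := hC
  have HB' : p ≤ 3 → ∀ᶠ N : ℕ in atTop, ∃ k : ℕ, 2 ≤ k ∧ IsSlow p (min a b) N (barbell k) :=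
    fun h => (HB h).mono fun N ⟨k, hk, H⟩ => ⟨k, hk, mono (min_le_left a b) H⟩
  have HC' : 3 ≤ p → ∀ᶠ N : ℕ in atTop, ∃ m : ℕ, 3 ≤ m ∧
      IsSlow p (min a b) N (SimpleGraph.cycleGraph m) :=
    fun h => (HC h).mono fun N ⟨m, hm, H⟩ => ⟨m, hm, mono (min_le_right a b) H⟩
  refine ⟨min a b, lt_min ha hb, ?_, HB', HC'⟩
  rcases le_total p 3 with h | h
  · exact (HB' h).mono fun N ⟨k, _, H⟩ => ⟨_, _, H⟩
  · exact (HC' h).mono fun N ⟨m, _, H⟩ => ⟨_, _, H⟩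

end Cycle

end LpConsensus

theorem mainTheorem2 (p : ℝ) (hp : 1 < p) :
    (∃ C c : ℝ, 0 < C ∧ 0 < c ∧
      ∀ (V : Type*) [Fintype V] [MeasurableSpace V] [DiscreteMeasurableSpace V]
        (G : SimpleGraph V), G.Connected → 2 ≤ Fintype.card V →
      ∀ f₀ : V → ℝ, (∀ x, f₀ x ∈ Set.Icc (0 : ℝ) 1) →
      ∀ (Ω : Type*) [MeasurableSpace Ω] (P : Measure Ω) [IsProbabilityMeasure P]
        (v : ℕ → Ω → V), LpConsensus.IsUniformUpdates P v →
        (∀ t : ℕ,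
          Integrable
            (fun ω => LpConsensus.energy p G (LpConsensus.profile p G f₀ (fun s => v s ω) t)) P ∧
          ∫ ω, LpConsensus.energy p G (LpConsensus.profile p G f₀ (fun s => v s ω) t) ∂P ≤
            Real.exp (-(c * (Fintype.card V : ℝ) ^ (-LpConsensus.beta p) * t)) *
              LpConsensus.energy p G f₀) ∧
        (∀ ε : ℝ, 0 < ε → ε ≤ 1 / 2 →
          Measurable (fun ω => LpConsensus.consensusTime p G f₀ (fun s => v s ω) ε) ∧
          ∫⁻ ω, (LpConsensus.consensusTime p G f₀ (fun s => v s ω) ε : ℝ≥0∞) ∂P ≤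
            ENNReal.ofReal (C * (Fintype.card V : ℝ) ^ LpConsensus.beta p *
              Real.log ((Fintype.card V : ℝ) / ε)))) ∧
    (∃ a : ℝ, 0 < a ∧
      (∀ᶠ N : ℕ in atTop, ∃ (n : ℕ) (G : SimpleGraph (Fin n)), LpConsensus.IsSlow p a N G) ∧
      (p ≤ 3 → ∀ᶠ N : ℕ in atTop, ∃ k : ℕ, 2 ≤ k ∧
        LpConsensus.IsSlow p a N (LpConsensus.barbell k)) ∧
      (3 ≤ p → ∀ᶠ N : ℕ in atTop, ∃ m : ℕ, 3 ≤ m ∧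
        LpConsensus.IsSlow p a N (SimpleGraph.cycleGraph m))) :=
  ⟨LpConsensus.exists_energy_and_consensusTime_bounds hp, LpConsensus.exists_isSlow hp⟩
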